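/- Let $n\ge 2$. There exist a velocity field $v\in L^\infty(\mathbb{R}^n_x\times\mathbb{R}_t;\mathbb{R}^n)$ and a pressure $p\in L^\infty(\mathbb{R}^n_x\times\mathbb{R}_t)$ that solve the incompressible Euler equations without force, $$\partial_t v+\operatorname{div}(v\otimes v)+\nabla p=0,\qquad \operatorname{div} v=0,$$ in the sense of distributions on $\mathbb{R}^n_x\times\mathbb{R}_t$, that is, $$\int \Big(v_i\,\partial_t\varphi+\sum_{j=1}^n v_iv_j\,\partial_{x_j}\varphi+p\,\partial_{x_i}\varphi\Big)\,dx\,dt=0\quad(i=1,\dots,n),\qquad \int \sum_{i=1}^n v_i\,\partial_{x_i}\varphi\,dx\,dt=0$$ for every $\varphi\in C_c^\infty(\mathbb{R}^n_x\times\mathbb{R}_t)$, such that $v$ is not identically zero (i.e. it is not the case that $v=0$ almost everywhere), and $\operatorname{supp} v$ and $\operatorname{supp} p$ are compact in space-time $\mathbb{R}^n_x\times\mathbb{R}_t$. -/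

import Mathlib

open MeasureTheory
open scoped ContDiff ENNReal

/-- Space-time `ℝⁿ × ℝ`; a point is `(x, t)`, and `volume` is Lebesgue measure. -/
abbrev SpaceTime (n : ℕ) : Type := EuclideanSpace ℝ (Fin n) × ℝ

/-- The spatial partial derivative `∂φ/∂xᵢ` of a function on space-time. -/
noncomputable def spaceDeriv {n : ℕ} (i : Fin n) (φ : SpaceTime n → ℝ) (y : SpaceTime n) : ℝ :=
  fderiv ℝ φ y (EuclideanSpace.single i 1, 0)

/-- The time derivative `∂φ/∂t` of a function on space-time. -/
noncomputable def timeDeriv {n : ℕ} (φ : SpaceTime n → ℝ) (y : SpaceTime n) : ℝ :=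
  fderiv ℝ φ y (0, 1)

/-- A scalar test function: `φ ∈ C_c^∞(ℝⁿ × ℝ)`. -/
def IsTestFunction {n : ℕ} (φ : SpaceTime n → ℝ) : Prop :=
  ContDiff ℝ ∞ φ ∧ HasCompactSupport φ

/-- `(v, p)` solves the Euler equations
`∂ₜ v + div (v ⊗ v) + ∇ p - f = 0`, `div v = 0`
with force `f` on `ℝⁿ × ℝ` in the sense of distributions. The
integrability conditions say that every term defines a distribution; the vector equation is tested
component by component. -/
structure IsDistributionalEulerSolution (n : ℕ)
    (v : SpaceTime n → EuclideanSpace ℝ (Fin n)) (p : SpaceTime n → ℝ)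
    (f : SpaceTime n → EuclideanSpace ℝ (Fin n)) : Prop where
  locallyIntegrable_velocity : LocallyIntegrable v
  locallyIntegrable_tensor : ∀ i j : Fin n, LocallyIntegrable fun y => v y i * v y j
  locallyIntegrable_pressure : LocallyIntegrable p
  locallyIntegrable_force : LocallyIntegrable f
  momentum : ∀ φ : SpaceTime n → ℝ, IsTestFunction φ → ∀ i : Fin n,
    ∫ y, (v y i * timeDeriv φ y + ∑ j : Fin n, v y i * v y j * spaceDeriv j φ y
      + p y * spaceDeriv i φ y + f y i * φ y) = 0
  incompressible : ∀ φ : SpaceTime n → ℝ, IsTestFunction φ →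
    ∫ y, ∑ i : Fin n, v y i * spaceDeriv i φ y = 0

/-! Convex integration through a differential inclusion. The Euler system is split into the linear
system `∂ₜ v + div u = 0`, `div v = 0`, with `u` symmetric and traceless, and the pointwise
constraint `u = v ⊗ v - n⁻¹ Id`. The constraint is relaxed to positivity of the defect `n⁻¹ Id - v ⊗
v + u`, whose trace is `1 - |v|²`. A nonnegative form is controlled by its trace, so pushing `|v|`
up to `1` on the unit ball of space-time forces `u` to `v ⊗ v - n⁻¹ Id` there: the limit solves
Euler with pressure `-1/n` in the ball, and everything vanishes outside. The pair `(0, 0)` is an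
admissible start, and a limit of modulus one on the ball is not zero.

To raise `|v|`, note that at each point the defect dominates a multiple of some `e ⊗ e`
(`exists_direction`). If `v = α e + β ξ` with `ξ ⊥ e`, then `(e, β (e ⊗ ξ + ξ ⊗ e))` times any
function of `ξ · x - β t` solves the linear system, and adding it changes the defect only along `e ⊗
e` (`defectForm_add_wave`). Such waves are localized by cutting off a third-order potential
(`isLinearSolution_potential`, `exists_bound_potential_wave`). Placed in disjoint balls, they move
`v` in `L²` by at least a fixed multiple of `∫ (1 - |v|²)²`, while Riemann–Lebesgue makes them
nearly orthogonal to any finite set of fields (`IsStrictSubsolution.exists_perturbation`).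

Near-orthogonality to all earlier terms and the `L²` bound make the iterates Cauchy
(`cauchySeq_of_almost_orthogonal`). The increments then tend to zero, hence so does the integrated
squared defect, and strong convergence allows passing to the limit in `v ⊗ v`. -/

/-! ### Directional derivatives and oscillating potentials -/

section DirDeriv

variable {V : Type*} [NormedAddCommGroup V] [NormedSpace ℝ V]

/-- The directional derivative of a scalar function, as an operator on functions. -/
noncomputable def dirDeriv (a : V) (f : V → ℝ) (y : V) : ℝ := fderiv ℝ f y a

theorem ContDiff.dirDeriv {f : V → ℝ} (hf : ContDiff ℝ ∞ f) (a : V) :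
    ContDiff ℝ ∞ (dirDeriv a f) :=
  (hf.fderiv_right (m := ∞) (by simp)).clm_apply contDiff_const

theorem HasCompactSupport.dirDeriv {f : V → ℝ} (hf : HasCompactSupport f) (a : V) :
    HasCompactSupport (dirDeriv a f) := by
  refine (hf.fderiv (𝕜 := ℝ)).mono fun y hy => ?_
  contrapose! hy
  have : fderiv ℝ f y = 0 := by simpa using hy
  simp [_root_.dirDeriv, this]

theorem dirDeriv_eq_zero_of_notMem_tsupport {f : V → ℝ} {y : V} (hy : y ∉ tsupport f) (a : V) :
    dirDeriv a f y = 0 := by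
  have : fderiv ℝ f y = 0 := by
    by_contra h
    exact hy (support_fderiv_subset ℝ h)
  simp [dirDeriv, this]

theorem tsupport_dirDeriv_subset (f : V → ℝ) (a : V) : tsupport (dirDeriv a f) ⊆ tsupport f := by
  refine closure_minimal (fun y hy => ?_) (isClosed_tsupport f)
  by_contra h
  exact hy (dirDeriv_eq_zero_of_notMem_tsupport h a)

theorem dirDeriv_comm {f : V → ℝ} (hf : ContDiff ℝ ∞ f) (a b : V) :
    dirDeriv a (dirDeriv b f) = dirDeriv b (dirDeriv a f) := by
  funext y
  have hs : IsSymmSndFDerivAt ℝ f y := hf.contDiffAt.isSymmSndFDerivAt (by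
    simpa using (WithTop.coe_le_coe.2 le_top : ((2 : ℕ∞) : WithTop ℕ∞) ≤ ((⊤ : ℕ∞) : WithTop ℕ∞)))
  have hd : DifferentiableAt ℝ (fderiv ℝ f) y :=
    ((hf.fderiv_right (m := ∞) (by simp)).differentiable (by simp)) y
  have key : ∀ c d : V, dirDeriv c (dirDeriv d f) y = fderiv ℝ (fderiv ℝ f) y c d := by
    intro c d
    have h : HasFDerivAt (dirDeriv d f) _ y := hd.hasFDerivAt.clm_apply (hasFDerivAt_const d y)
    rw [dirDeriv, h.fderiv]
    simp
  rw [key, key, hs.eq]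

theorem dirDeriv_add {f g : V → ℝ} (hf : ContDiff ℝ ∞ f) (hg : ContDiff ℝ ∞ g) (a : V) :
    dirDeriv a (fun y => f y + g y) = fun y => dirDeriv a f y + dirDeriv a g y := by
  funext y
  simp only [dirDeriv]
  rw [fderiv_fun_add (hf.differentiable (by simp) y) (hg.differentiable (by simp) y)]
  simp

theorem dirDeriv_const_mul {f : V → ℝ} (hf : ContDiff ℝ ∞ f) (c : ℝ) (a : V) :
    dirDeriv a (fun y => c * f y) = fun y => c * dirDeriv a f y := by
  funext y
  simp only [dirDeriv]
  rw [fderiv_const_mul (hf.differentiable (by simp) y)]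
  simp

theorem dirDeriv_sub {f g : V → ℝ} (hf : ContDiff ℝ ∞ f) (hg : ContDiff ℝ ∞ g) (a : V) :
    dirDeriv a (fun y => f y - g y) = fun y => dirDeriv a f y - dirDeriv a g y := by
  funext y
  simp only [dirDeriv]
  rw [fderiv_fun_sub (hf.differentiable (by simp) y) (hg.differentiable (by simp) y)]
  simp

theorem dirDeriv_zero (a : V) : dirDeriv a (fun _ => 0) = fun _ => (0 : ℝ) := by
  funext y
  simp [dirDeriv]

/-- Product rule for amplitudes modulated by the phase `N ℓ`. -/
theorem dirDeriv_sin_add_cos {f g : V → ℝ} (hf : ContDiff ℝ ∞ f) (hg : ContDiff ℝ ∞ g)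
    (l : StrongDual ℝ V) (N : ℝ) (a : V) :
    dirDeriv a (fun y => f y * Real.sin (N * l y) + g y * Real.cos (N * l y)) =
      fun y => (dirDeriv a f y - N * l a * g y) * Real.sin (N * l y) +
        (dirDeriv a g y + N * l a * f y) * Real.cos (N * l y) := by
  funext y
  have hl : HasFDerivAt (fun y => N * l y) (N • l) y := l.hasFDerivAt.const_mul N
  have h := ((hf.differentiable (by simp) y).hasFDerivAt.mul hl.sin).add
    ((hg.differentiable (by simp) y).hasFDerivAt.mul hl.cos)
  have h' : HasFDerivAt (fun y => f y * Real.sin (N * l y) + g y * Real.cos (N * l y)) _ y := h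
  rw [dirDeriv, h'.fderiv]
  simp [dirDeriv]
  ring

/-- The potential `-N⁻³ φ sin (N ℓ)`, whose third derivatives are `φ cos (N ℓ)` to leading order. -/
noncomputable def wavePotential (φ : V → ℝ) (l : StrongDual ℝ V) (N : ℝ) (y : V) : ℝ :=
  -(N⁻¹) ^ 3 * (φ y * Real.sin (N * l y))

theorem contDiff_wavePotential {φ : V → ℝ} (hφ : ContDiff ℝ ∞ φ) (l : StrongDual ℝ V) (N : ℝ) :
    ContDiff ℝ ∞ (wavePotential φ l N) :=
  contDiff_const.mul (hφ.mul (Real.contDiff_sin.comp (contDiff_const.mul l.contDiff)))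

theorem tsupport_wavePotential_subset (φ : V → ℝ) (l : StrongDual ℝ V) (N : ℝ) :
    tsupport (wavePotential φ l N) ⊆ tsupport φ := by
  refine closure_mono fun y hy => ?_
  contrapose! hy
  have : φ y = 0 := by simpa using hy
  simp [wavePotential, this]

/-- The only `N ^ 3` term carries no derivative of `φ`; all others have at most `N ^ 2`, so the
prefactor makes them `O(1/N)`. -/
theorem dirDeriv_three_wavePotential {φ : V → ℝ} (hφ : ContDiff ℝ ∞ φ) (l : StrongDual ℝ V)
    (N : ℝ) (a b c : V) (y : V) :
    dirDeriv a (dirDeriv b (dirDeriv c (wavePotential φ l N))) y =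
      -(N⁻¹) ^ 3 *
        ((dirDeriv a (dirDeriv b (dirDeriv c φ)) y - N ^ 2 * (l b * l c * dirDeriv a φ y
            + l a * l c * dirDeriv b φ y + l a * l b * dirDeriv c φ y)) * Real.sin (N * l y)
          + (N * (l c * dirDeriv a (dirDeriv b φ) y + l b * dirDeriv a (dirDeriv c φ) y
            + l a * dirDeriv b (dirDeriv c φ) y) - N ^ 3 * (l a * l b * l c) * φ y)
            * Real.cos (N * l y)) := by
  have h0 : wavePotential φ l N = fun y => (-(N⁻¹) ^ 3 * φ y) * Real.sin (N * l y)
      + (0 : ℝ) * Real.cos (N * l y) := by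
    funext y
    simp only [wavePotential]
    ring
  set k := -(N⁻¹) ^ 3
  have e1 := hφ.dirDeriv c
  have e2 := hφ.dirDeriv b
  have e3 := e1.dirDeriv b
  have z : ContDiff ℝ ∞ (fun _ : V => (0 : ℝ)) := contDiff_const
  rw [h0, dirDeriv_sin_add_cos (contDiff_const.mul hφ) z, dirDeriv_zero,
    dirDeriv_const_mul hφ]
  have h1 : (fun y => (k * dirDeriv c φ y - N * l c * 0) * Real.sin (N * l y)
      + (0 + N * l c * (k * φ y)) * Real.cos (N * l y)) =
      fun y => (k * dirDeriv c φ y) * Real.sin (N * l y)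
      + ((N * l c * k) * φ y) * Real.cos (N * l y) := by
    funext y; ring
  rw [h1, dirDeriv_sin_add_cos (contDiff_const.mul e1) (contDiff_const.mul hφ),
    dirDeriv_const_mul e1, dirDeriv_const_mul hφ]
  have h2 : (fun y => (k * dirDeriv b (dirDeriv c φ) y - N * l b * (N * l c * k * φ y))
        * Real.sin (N * l y)
      + (N * l c * k * dirDeriv b φ y + N * l b * (k * dirDeriv c φ y)) * Real.cos (N * l y)) =
      fun y => (k * dirDeriv b (dirDeriv c φ) y - (N ^ 2 * (l b * l c * k)) * φ y)
        * Real.sin (N * l y)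
      + ((N * l c * k) * dirDeriv b φ y + (N * l b * k) * dirDeriv c φ y)
        * Real.cos (N * l y) := by
    funext y; ring
  rw [h2, dirDeriv_sin_add_cos ((contDiff_const.mul e3).sub (contDiff_const.mul hφ))
      ((contDiff_const.mul e2).add (contDiff_const.mul e1)),
    dirDeriv_sub (contDiff_const.mul e3) (contDiff_const.mul hφ),
    dirDeriv_add (contDiff_const.mul e2) (contDiff_const.mul e1),
    dirDeriv_const_mul e3, dirDeriv_const_mul hφ, dirDeriv_const_mul e2, dirDeriv_const_mul e1]
  ring

/-- Third derivatives of the potential agree with the plane wave up to `O(1/N)`. -/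
theorem exists_bound_dirDeriv_wavePotential {φ : V → ℝ} (hφ : ContDiff ℝ ∞ φ)
    (hc : HasCompactSupport φ) (l : StrongDual ℝ V) (a b c : V) :
    ∃ C : ℝ, ∀ N : ℝ, 1 ≤ N → ∀ y,
      |dirDeriv a (dirDeriv b (dirDeriv c (wavePotential φ l N))) y
        - l a * l b * l c * (φ y * Real.cos (N * l y))| ≤ C / N := by
  have bd : ∀ {f : V → ℝ}, ContDiff ℝ ∞ f → HasCompactSupport f → ∃ C, ∀ y, |f y| ≤ C :=
    fun hf hs => hs.exists_bound_of_continuous hf.continuous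
  obtain ⟨A, hA⟩ := bd (((hφ.dirDeriv c).dirDeriv b).dirDeriv a)
    (((hc.dirDeriv c).dirDeriv b).dirDeriv a)
  have h1 : ContDiff ℝ ∞ (fun y => l b * l c * dirDeriv a φ y
            + l a * l c * dirDeriv b φ y + l a * l b * dirDeriv c φ y) :=
    ((contDiff_const.mul (hφ.dirDeriv a)).add (contDiff_const.mul (hφ.dirDeriv b))).add
      (contDiff_const.mul (hφ.dirDeriv c))
  have h1' : HasCompactSupport (fun y => l b * l c * dirDeriv a φ y
            + l a * l c * dirDeriv b φ y + l a * l b * dirDeriv c φ y) :=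
    (((hc.dirDeriv a).mul_left (f := fun _ => l b * l c)).add
      ((hc.dirDeriv b).mul_left (f := fun _ => l a * l c))).add
      ((hc.dirDeriv c).mul_left (f := fun _ => l a * l b))
  have h2 : ContDiff ℝ ∞ (fun y => l c * dirDeriv a (dirDeriv b φ) y
            + l b * dirDeriv a (dirDeriv c φ) y + l a * dirDeriv b (dirDeriv c φ) y) :=
    ((contDiff_const.mul ((hφ.dirDeriv b).dirDeriv a)).add
      (contDiff_const.mul ((hφ.dirDeriv c).dirDeriv a))).add
      (contDiff_const.mul ((hφ.dirDeriv c).dirDeriv b))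
  have h2' : HasCompactSupport (fun y => l c * dirDeriv a (dirDeriv b φ) y
            + l b * dirDeriv a (dirDeriv c φ) y + l a * dirDeriv b (dirDeriv c φ) y) :=
    ((((hc.dirDeriv b).dirDeriv a).mul_left (f := fun _ => l c)).add
      (((hc.dirDeriv c).dirDeriv a).mul_left (f := fun _ => l b))).add
      (((hc.dirDeriv c).dirDeriv b).mul_left (f := fun _ => l a))
  obtain ⟨B, hB⟩ := bd h1 h1'
  obtain ⟨C, hC⟩ := bd h2 h2'
  refine ⟨A + B + C, fun N hN y => ?_⟩
  have hN0 : 0 < N := by linarith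
  rw [dirDeriv_three_wavePotential hφ]
  have hA := hA y
  have hB := hB y
  have hC := hC y
  set p := dirDeriv a (dirDeriv b (dirDeriv c φ)) y
  set q := l b * l c * dirDeriv a φ y + l a * l c * dirDeriv b φ y + l a * l b * dirDeriv c φ y
  set r := l c * dirDeriv a (dirDeriv b φ) y
            + l b * dirDeriv a (dirDeriv c φ) y + l a * dirDeriv b (dirDeriv c φ) y
  set S := Real.sin (N * l y)
  set K := Real.cos (N * l y)
  have hS : |S| ≤ 1 := Real.abs_sin_le_one _
  have hK : |K| ≤ 1 := Real.abs_cos_le_one _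
  have e : -(N⁻¹) ^ 3 * ((p - N ^ 2 * q) * S + (N * r - N ^ 3 * (l a * l b * l c) * φ y) * K)
      - l a * l b * l c * (φ y * K) = (-(p * S) * (N⁻¹) ^ 2 + q * S - r * K * N⁻¹) * N⁻¹ := by
    field_simp
    ring
  rw [e, abs_mul, abs_of_pos (inv_pos.2 hN0), div_eq_mul_inv]
  have hi : N⁻¹ ≤ 1 := inv_le_one_of_one_le₀ hN
  have hi0 : 0 < N⁻¹ := inv_pos.2 hN0
  gcongr
  have t1 : |(p * S) * (N⁻¹) ^ 2| ≤ A := by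
    rw [abs_mul, abs_mul, abs_of_nonneg (by positivity : 0 ≤ N⁻¹ ^ 2)]
    calc |p| * |S| * N⁻¹ ^ 2 ≤ |p| * 1 * 1 := by
          gcongr
          exact pow_le_one₀ hi0.le hi
      _ ≤ A := by simpa using hA
  have t2 : |q * S| ≤ B := by
    rw [abs_mul]
    calc |q| * |S| ≤ |q| * 1 := by gcongr
      _ ≤ B := by simpa using hB
  have t3 : |r * K * N⁻¹| ≤ C := by
    rw [abs_mul, abs_mul, abs_of_pos hi0]
    calc |r| * |K| * N⁻¹ ≤ |r| * 1 * 1 := by gcongr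
      _ ≤ C := by simpa using hC
  rw [abs_le] at *
  constructor <;> linarith [t1.1, t1.2]

/-! ### Integration by parts and the Riemann–Lebesgue lemma. -/

variable [MeasurableSpace V] [BorelSpace V] [FiniteDimensional ℝ V]

theorem integral_mul_dirDeriv {μ : Measure V} [μ.IsAddHaarMeasure] {f g : V → ℝ}
    (hf : ContDiff ℝ ∞ f) (hg : ContDiff ℝ ∞ g) (hc : HasCompactSupport f) (a : V) :
    ∫ y, f y * dirDeriv a g y ∂μ = -∫ y, dirDeriv a f y * g y ∂μ := by
  refine integral_mul_fderiv_eq_neg_fderiv_mul_of_integrable ?_ ?_ ?_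
    (fun x _ => hf.differentiable (by simp) x) (fun x _ => hg.differentiable (by simp) x)
  · exact ((hf.dirDeriv a).continuous.mul hg.continuous).integrable_of_hasCompactSupport
      ((hc.dirDeriv a).mul_right)
  · exact (hf.continuous.mul (hg.dirDeriv a).continuous).integrable_of_hasCompactSupport
      hc.mul_right
  · exact (hf.continuous.mul hg.continuous).integrable_of_hasCompactSupport hc.mul_right

/-- Riemann–Lebesgue lemma for real plane waves of increasing frequency. -/
theorem tendsto_integral_mul_cos {μ : Measure V} [μ.IsAddHaarMeasure] {f : V → ℝ}
    (hf : Integrable f μ) {l : StrongDual ℝ V} (hl : l ≠ 0) :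
    Filter.Tendsto (fun N : ℝ => ∫ y, f y * Real.cos (N * l y) ∂μ) Filter.atTop (nhds 0) := by
  have h := tendsto_integral_exp_smul_cocompact (fun y => (f y : ℂ)) μ
  -- The character contributes `exp (-2πi w(y))`, so the dual vector `w = -(N / 2π) l` produces `exp
  -- (i N l y)`.
  have hm : Filter.Tendsto (fun N : ℝ => (-(N / (2 * Real.pi))) • l) Filter.atTop
      (Filter.cocompact (StrongDual ℝ V)) := by
    have : ProperSpace (StrongDual ℝ V) := FiniteDimensional.proper ℝ _
    rw [← Metric.cobounded_eq_cocompact, ← tendsto_norm_atTop_iff_cobounded]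
    simp only [norm_smul, norm_neg]
    refine Filter.Tendsto.atTop_mul_const (norm_pos_iff.2 hl) ?_
    exact tendsto_norm_atTop_atTop.comp (Filter.tendsto_id.atTop_div_const (by positivity))
  have h2 := (Complex.continuous_re.tendsto 0).comp (h.comp hm)
  simp only [Complex.zero_re] at h2
  refine h2.congr fun N => ?_
  simp only [Function.comp]
  have hint : Integrable (fun y => Real.fourierChar (-((-(N / (2 * Real.pi))) • l) y)
      • (f y : ℂ)) μ := by
    refine (integrable_norm_iff ?_).1 ?_
    · refine AEStronglyMeasurable.smul (Continuous.aestronglyMeasurable ?_) hf.ofReal.1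
      fun_prop
    · simpa using hf.norm
  have := integral_re hint
  simp only [RCLike.re_to_complex] at this
  rw [← this]
  refine integral_congr_ae (Filter.Eventually.of_forall fun y => ?_)
  simp only [Circle.smul_def, Real.fourierChar_apply]
  have : (2 * Real.pi * (-((-(N / (2 * Real.pi))) • l) y) : ℝ) = N * l y := by
    simp
    field_simp
  rw [this, smul_eq_mul, Complex.re_mul_ofReal, Complex.exp_ofReal_mul_I_re, mul_comm]

end DirDeriv

/-! ### The defect form of a subsolution at a point -/

section Defect

variable {n : ℕ}

theorem inner_single_one (x : EuclideanSpace ℝ (Fin n)) (i : Fin n) :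
    inner ℝ x (EuclideanSpace.single i (1 : ℝ)) = x i := by
  simp [EuclideanSpace.inner_single_right]

noncomputable instance bilinFormNormedAddCommGroup (n : ℕ) : NormedAddCommGroup
    (EuclideanSpace ℝ (Fin n) →L[ℝ] EuclideanSpace ℝ (Fin n) →L[ℝ] ℝ) := inferInstance

noncomputable instance bilinFormNormedSpace (n : ℕ) : NormedSpace ℝ
    (EuclideanSpace ℝ (Fin n) →L[ℝ] EuclideanSpace ℝ (Fin n) →L[ℝ] ℝ) := inferInstance

/-- The bilinear form `a ⊗ b`. -/
noncomputable def tensorForm (a b : EuclideanSpace ℝ (Fin n)) :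
    EuclideanSpace ℝ (Fin n) →L[ℝ] EuclideanSpace ℝ (Fin n) →L[ℝ] ℝ :=
  (innerSL ℝ a).smulRight (innerSL ℝ b)

@[simp]
theorem tensorForm_apply (a b x y : EuclideanSpace ℝ (Fin n)) :
    tensorForm a b x y = inner ℝ a x * inner ℝ b y := by
  simp [tensorForm]

/-- The quadratic form of `n⁻¹ Id - v ⊗ v + u`. -/
noncomputable def defectForm (v : EuclideanSpace ℝ (Fin n))
    (u : EuclideanSpace ℝ (Fin n) →L[ℝ] EuclideanSpace ℝ (Fin n) →L[ℝ] ℝ)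
    (x : EuclideanSpace ℝ (Fin n)) : ℝ :=
  ‖x‖ ^ 2 / n - inner ℝ v x ^ 2 + u x x

/-- The trace of a bilinear form on `ℝⁿ`. -/
noncomputable def formTrace
    (u : EuclideanSpace ℝ (Fin n) →L[ℝ] EuclideanSpace ℝ (Fin n) →L[ℝ] ℝ) : ℝ :=
  ∑ i, u (EuclideanSpace.single i 1) (EuclideanSpace.single i 1)

theorem formTrace_tensorForm (a b : EuclideanSpace ℝ (Fin n)) :
    formTrace (tensorForm a b) = inner ℝ a b := by
  simp [formTrace, PiLp.inner_apply, mul_comm]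

theorem formTrace_add (u w : EuclideanSpace ℝ (Fin n) →L[ℝ] EuclideanSpace ℝ (Fin n) →L[ℝ] ℝ) :
    formTrace (u + w) = formTrace u + formTrace w := by
  simp [formTrace, Finset.sum_add_distrib]

theorem formTrace_smul (c : ℝ)
    (u : EuclideanSpace ℝ (Fin n) →L[ℝ] EuclideanSpace ℝ (Fin n) →L[ℝ] ℝ) :
    formTrace (c • u) = c * formTrace u := by
  simp [formTrace, Finset.mul_sum]

variable {v : EuclideanSpace ℝ (Fin n)}
  {u : EuclideanSpace ℝ (Fin n) →L[ℝ] EuclideanSpace ℝ (Fin n) →L[ℝ] ℝ}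

/-- The link between constraint and energy: `n⁻¹ Id` has trace one, `u` has trace zero and `v ⊗ v`
has trace `‖v‖ ^ 2`. -/
theorem sum_defectForm_single (hn : n ≠ 0) (htr : formTrace u = 0) :
    ∑ i, defectForm v u (EuclideanSpace.single i 1) = 1 - ‖v‖ ^ 2 := by
  have hn' : (n : ℝ) ≠ 0 := by exact_mod_cast hn
  simp only [formTrace] at htr
  simp only [defectForm, Finset.sum_add_distrib, Finset.sum_sub_distrib, htr,
    EuclideanSpace.norm_sq_eq v]
  simp [hn', inner_single_one]

theorem defectForm_single_le (hn : n ≠ 0) (htr : formTrace u = 0)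
    (h : ∀ x, 0 ≤ defectForm v u x) (i : Fin n) :
    defectForm v u (EuclideanSpace.single i 1) ≤ 1 - ‖v‖ ^ 2 := by
  rw [← sum_defectForm_single hn htr]
  exact Finset.single_le_sum (f := fun i => defectForm v u (EuclideanSpace.single i 1))
    (fun i _ => h _) (Finset.mem_univ i)

/-- The middle coefficient is the polarized defect form; polarization and Cauchy–Schwarz below both
rest on this expansion. -/
theorem defectForm_add_smul (hs : ∀ x y, u x y = u y x) (x y : EuclideanSpace ℝ (Fin n)) (t : ℝ) :
    defectForm v u (x + t • y) = defectForm v u x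
      + 2 * t * (inner ℝ x y / n - inner ℝ v x * inner ℝ v y + u x y)
      + t ^ 2 * defectForm v u y := by
  simp only [defectForm, norm_add_sq_real, inner_add_right, inner_smul_right, norm_smul, map_add,
    map_smul, add_apply, smul_apply, smul_eq_mul, hs y x,
    Real.norm_eq_abs, mul_pow, sq_abs]
  ring

/-- The entries of a nonnegative defect form are bounded by its trace. -/
theorem abs_defect_entry_le (hn : n ≠ 0) (hs : ∀ x y, u x y = u y x) (htr : formTrace u = 0)
    (h : ∀ x, 0 ≤ defectForm v u x) (i j : Fin n) :
    |(if i = j then 1 else 0) / (n : ℝ) - v i * v j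
      + u (EuclideanSpace.single i 1) (EuclideanSpace.single j 1)| ≤ 1 - ‖v‖ ^ 2 := by
  have hi := defectForm_single_le hn htr h i
  have hj := defectForm_single_le hn htr h j
  -- Polarization: nonnegativity at `t = ±1` bounds twice the off-diagonal entry by the sum of two
  -- diagonal entries.
  have h1 := h (EuclideanSpace.single i 1 + (1 : ℝ) • EuclideanSpace.single j 1)
  have h2 := h (EuclideanSpace.single i 1 + (-1 : ℝ) • EuclideanSpace.single j 1)
  rw [defectForm_add_smul hs] at h1 h2
  have hij : (inner ℝ (EuclideanSpace.single i (1 : ℝ)) (EuclideanSpace.single j (1 : ℝ)) : ℝ)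
      = if i = j then 1 else 0 := by
    simp [inner_single_one, eq_comm]
  have hvi : ∀ k, (inner ℝ v (EuclideanSpace.single k (1 : ℝ)) : ℝ) = v k := inner_single_one v
  rw [hij, hvi, hvi] at h1 h2
  rw [abs_le]
  constructor <;> linarith

/-- A nonnegative defect form dominates a rank-one form of size comparable to its trace. -/
theorem exists_direction (hn : n ≠ 0) (hs : ∀ x y, u x y = u y x) (htr : formTrace u = 0)
    (h : ∀ x, 0 ≤ defectForm v u x) (hv : ‖v‖ < 1) :
    ∃ e : EuclideanSpace ℝ (Fin n), ‖e‖ = 1 ∧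
      ∀ x, (1 - ‖v‖ ^ 2) / n * inner ℝ e x ^ 2 ≤ defectForm v u x := by
  have hn' : (0 : ℝ) < n := by exact_mod_cast Nat.pos_of_ne_zero hn
  have hT : 0 < 1 - ‖v‖ ^ 2 := by nlinarith [norm_nonneg v]
  -- Some diagonal entry is at least the average of the trace.
  obtain ⟨i, hi⟩ : ∃ i, (1 - ‖v‖ ^ 2) / n ≤ defectForm v u (EuclideanSpace.single i 1) := by
    by_contra! hlt
    have : Nonempty (Fin n) := ⟨⟨0, Nat.pos_of_ne_zero hn⟩⟩
    have h1 := Finset.sum_lt_sum_of_nonempty (s := Finset.univ) Finset.univ_nonempty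
      (fun i _ => hlt i)
    rw [sum_defectForm_single hn htr] at h1
    simp at h1
    field_simp at h1
    linarith
  set c := EuclideanSpace.single i (1 : ℝ) with hc
  set m := defectForm v u c with hm
  have hm0 : 0 < m := lt_of_lt_of_le (by positivity) hi
  -- `b` is the Riesz representative of the polarized defect form with one argument fixed at `c`.
  set b := (InnerProductSpace.toDual ℝ (EuclideanSpace ℝ (Fin n))).symm
    ((n : ℝ)⁻¹ • innerSL ℝ c - (inner ℝ v c) • innerSL ℝ v + u c) with hb
  have hbx : ∀ x, inner ℝ b x = inner ℝ x c / n - inner ℝ v x * inner ℝ v c + u x c := by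
    intro x
    rw [hb, InnerProductSpace.toDual_symm_apply]
    simp only [add_apply, sub_apply,
      smul_apply, innerSL_apply_apply, smul_eq_mul, hs c x,
      real_inner_comm c x]
    ring
  have hbc : inner ℝ b c = m := by
    rw [hbx, hm, defectForm, real_inner_self_eq_norm_sq]
    ring
  have hcn : ‖c‖ = 1 := by simp [hc]
  have hbm : m ≤ ‖b‖ := by
    have := real_inner_le_norm b c
    rwa [hbc, hcn, mul_one] at this
  have hb0 : 0 < ‖b‖ := hm0.trans_le hbm
  refine ⟨‖b‖⁻¹ • b, by rw [norm_smul, norm_inv, norm_norm, inv_mul_cancel₀ hb0.ne'], fun x => ?_⟩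
  -- Cauchy–Schwarz for the defect form: this is the minimizer on the line through `x` in direction
  -- `c`.
  have h1 := h (x + (-(inner ℝ b x / m)) • c)
  rw [defectForm_add_smul hs, ← hbx, ← hm] at h1
  have h2 : inner ℝ b x ^ 2 / m ≤ defectForm v u x := by
    have e : 2 * -(inner ℝ b x / m) * inner ℝ b x + (-(inner ℝ b x / m)) ^ 2 * m
        = -(inner ℝ b x ^ 2 / m) := by
      field_simp
      ring
    linarith
  have h3 : (inner ℝ (‖b‖⁻¹ • b) x : ℝ) ^ 2 = inner ℝ b x ^ 2 / ‖b‖ ^ 2 := by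
    rw [real_inner_smul_left, mul_pow, inv_pow]
    ring
  rw [h3]
  calc (1 - ‖v‖ ^ 2) / n * (inner ℝ b x ^ 2 / ‖b‖ ^ 2) ≤ m * (inner ℝ b x ^ 2 / m ^ 2) := by
        gcongr
    _ = inner ℝ b x ^ 2 / m := by field_simp
    _ ≤ _ := h2

/-- `ξ` and `β` will be the wave vector and speed of the perturbation. When `v` is parallel to `e`,
any unit `ξ ⊥ e` serves with `β = 0`; its existence needs `n ≥ 2`. -/
theorem exists_orthogonal_decomposition (hn : 2 ≤ n) (v : EuclideanSpace ℝ (Fin n))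
    {e : EuclideanSpace ℝ (Fin n)} (he : ‖e‖ = 1) :
    ∃ (ξ : EuclideanSpace ℝ (Fin n)) (α β : ℝ), ‖ξ‖ = 1 ∧ inner ℝ e ξ = (0 : ℝ) ∧
      v = α • e + β • ξ := by
  by_cases h : v - (inner ℝ e v : ℝ) • e = 0
  · obtain ⟨w, hw0, hw⟩ : ∃ w : EuclideanSpace ℝ (Fin n), w ≠ 0 ∧ inner ℝ e w = (0 : ℝ) := by
      by_contra! hcon
      have htop : (ℝ ∙ e)ᗮ = ⊥ := by
        rw [Submodule.eq_bot_iff]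
        intro w hw
        by_contra hne
        exact hcon w hne (Submodule.mem_orthogonal_singleton_iff_inner_right.1 hw)
      have h1 := (ℝ ∙ e).finrank_add_finrank_orthogonal
      have h2 := finrank_span_le_card (R := ℝ) ({e} : Set (EuclideanSpace ℝ (Fin n)))
      rw [htop] at h1
      simp at h1 h2
      omega
    refine ⟨‖w‖⁻¹ • w, inner ℝ e v, 0, ?_, ?_, ?_⟩
    · rw [norm_smul, norm_inv, norm_norm, inv_mul_cancel₀ (norm_ne_zero_iff.2 hw0)]
    · rw [inner_smul_right, hw, mul_zero]
    · rw [zero_smul, add_zero]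
      exact sub_eq_zero.1 h
  · set w := v - (inner ℝ e v : ℝ) • e
    have hw0 := norm_ne_zero_iff.2 h
    refine ⟨‖w‖⁻¹ • w, inner ℝ e v, ‖w‖, ?_, ?_, ?_⟩
    · rw [norm_smul, norm_inv, norm_norm, inv_mul_cancel₀ hw0]
    · rw [inner_smul_right, inner_sub_right, inner_smul_right, real_inner_self_eq_norm_sq, he]
      ring
    · rw [smul_smul, mul_inv_cancel₀ hw0, one_smul]
      simp [w]

/-- Moving along `±s (e, β (e ⊗ ξ + ξ ⊗ e))` keeps a definite proportion of the defect form. -/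
theorem defectForm_add_wave {e ξ : EuclideanSpace ℝ (Fin n)} {α β κ c s τ : ℝ}
    (he : ‖e‖ = 1) (hξ : inner ℝ e ξ = (0 : ℝ)) (hdec : v = α • e + β • ξ) (hv : ‖v‖ ≤ 1)
    (hκ : ∀ x, κ * inner ℝ e x ^ 2 ≤ defectForm v u x) (hc : ∀ x, c * ‖x‖ ^ 2 ≤ defectForm v u x)
    (hs1 : s ≤ 1) (hsκ : 4 * s ≤ κ) (hτ : |τ| ≤ s) (x : EuclideanSpace ℝ (Fin n)) :
    c / 4 * ‖x‖ ^ 2 ≤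
      defectForm (v + τ • e) (u + (τ * β) • (tensorForm e ξ + tensorForm ξ e)) x := by
  have hα : |α| ≤ 1 := by
    have h1 : inner ℝ e v = α := by
      rw [hdec, inner_add_right, inner_smul_right, inner_smul_right, hξ,
        real_inner_self_eq_norm_sq, he]
      ring
    rw [← h1]
    refine (abs_real_inner_le_norm e v).trans ?_
    rw [he, one_mul]
    exact hv
  -- The cross terms `τ β (e ⊗ ξ + ξ ⊗ e)` of `(v + τ e) ⊗ (v + τ e)` are cancelled by the change of
  -- `u`, which leaves only `e ⊗ e`.
  have e1 : defectForm (v + τ • e) (u + (τ * β) • (tensorForm e ξ + tensorForm ξ e)) x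
      = defectForm v u x - (2 * τ * α + τ ^ 2) * inner ℝ e x ^ 2 := by
    have hvx : (inner ℝ v x : ℝ) = α * inner ℝ e x + β * inner ℝ ξ x := by
      rw [hdec, inner_add_left, real_inner_smul_left, real_inner_smul_left]
    simp only [defectForm, inner_add_left, real_inner_smul_left, add_apply,
      smul_apply, tensorForm_apply, smul_eq_mul, hvx]
    ring
  have hs0 : 0 ≤ s := (abs_nonneg τ).trans hτ
  -- Together with `4 * s ≤ κ`, this spends at most three quarters of the defect.
  have h2 : 2 * τ * α + τ ^ 2 ≤ 3 * s := by
    have a1 : τ * α ≤ s * 1 := by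
      refine (le_abs_self _).trans ?_
      rw [abs_mul]
      gcongr
    have a2 : τ ^ 2 ≤ s * 1 := by
      rw [← sq_abs, sq]
      gcongr
      exact hτ.trans hs1
    linarith
  have h3 : (2 * τ * α + τ ^ 2) * inner ℝ e x ^ 2 ≤ 3 / 4 * (κ * inner ℝ e x ^ 2) := by
    have : (2 * τ * α + τ ^ 2) * (inner ℝ e x : ℝ) ^ 2 ≤ (3 / 4 * κ) * inner ℝ e x ^ 2 := by
      gcongr
      linarith
    linarith
  rw [e1]
  linarith [hκ x, hc x]

/-- Stability estimate for freezing coefficients at the centre of a ball. Of the `6 * η`, the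
difference of squares takes `5 * η` and `u` takes `η`. -/
theorem abs_defectForm_sub_le {v' : EuclideanSpace ℝ (Fin n)}
    {u' : EuclideanSpace ℝ (Fin n) →L[ℝ] EuclideanSpace ℝ (Fin n) →L[ℝ] ℝ} {η : ℝ}
    (hη : η ≤ 1) (hv : ‖v‖ ≤ 2) (hv' : ‖v' - v‖ ≤ η) (hu' : ‖u' - u‖ ≤ η)
    (x : EuclideanSpace ℝ (Fin n)) :
    |defectForm v' u' x - defectForm v u x| ≤ 6 * η * ‖x‖ ^ 2 := by
  have hη0 : 0 ≤ η := (norm_nonneg _).trans hv'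
  have e : defectForm v' u' x - defectForm v u x
      = -(inner ℝ (v' - v) x * inner ℝ (v' - v + (2 : ℝ) • v) x) + (u' - u) x x := by
    simp only [defectForm, inner_sub_left, inner_add_left, real_inner_smul_left,
      sub_apply]
    ring
  have h1 : |(inner ℝ (v' - v) x : ℝ)| ≤ η * ‖x‖ :=
    (abs_real_inner_le_norm _ _).trans (by gcongr)
  have h2 : |(inner ℝ (v' - v + (2 : ℝ) • v) x : ℝ)| ≤ 5 * ‖x‖ := by
    refine (abs_real_inner_le_norm _ _).trans ?_
    gcongr
    refine (norm_add_le _ _).trans ?_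
    rw [norm_smul, Real.norm_eq_abs, abs_two]
    linarith
  have h3 : |(u' - u) x x| ≤ η * ‖x‖ * ‖x‖ :=
    ((u' - u).le_opNorm₂ x x).trans (by gcongr)
  rw [e]
  refine (abs_add_le _ _).trans ?_
  rw [abs_neg, abs_mul]
  calc _ ≤ η * ‖x‖ * (5 * ‖x‖) + η * ‖x‖ * ‖x‖ := by gcongr
    _ = _ := by ring

end Defect

/-! ### Solutions of the linear system `∂ₜ v + div u = 0`, `div v = 0` -/

instance SpaceTime.isAddHaarMeasure_volume (n : ℕ) :
    (volume : Measure (SpaceTime n)).IsAddHaarMeasure :=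
  inferInstanceAs ((volume : Measure (EuclideanSpace ℝ (Fin n))).prod
    (volume : Measure ℝ)).IsAddHaarMeasure

section LinearSystem

set_option synthInstance.maxHeartbeats 200000

variable {n : ℕ}

/-- Continuous distributional solutions `(v, u)` of `∂ₜ v + div u = 0`, `div v = 0` with `u`
symmetric and traceless. -/
structure IsLinearSolution (v : SpaceTime n → EuclideanSpace ℝ (Fin n))
    (u : SpaceTime n → EuclideanSpace ℝ (Fin n) →L[ℝ] EuclideanSpace ℝ (Fin n) →L[ℝ] ℝ) :
    Prop where
  continuous_velocity : Continuous v
  continuous_stress : Continuous u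
  symm : ∀ y a b, u y a b = u y b a
  trace : ∀ y, formTrace (u y) = 0
  momentum : ∀ φ : SpaceTime n → ℝ, IsTestFunction φ → ∀ x : EuclideanSpace ℝ (Fin n),
    ∫ y, (inner ℝ (v y) x * timeDeriv φ y
      + ∑ j, u y x (EuclideanSpace.single j 1) * spaceDeriv j φ y) = 0
  incompressible : ∀ φ : SpaceTime n → ℝ, IsTestFunction φ →
    ∫ y, ∑ i, v y i * spaceDeriv i φ y = 0

theorem timeDeriv_eq_dirDeriv (φ : SpaceTime n → ℝ) :
    timeDeriv φ = dirDeriv ((0 : EuclideanSpace ℝ (Fin n)), (1 : ℝ)) φ := rfl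

theorem sum_mul_spaceDeriv (a : EuclideanSpace ℝ (Fin n)) (φ : SpaceTime n → ℝ)
    (y : SpaceTime n) :
    ∑ j, a j * spaceDeriv j φ y = dirDeriv (a, (0 : ℝ)) φ y := by
  have ha : ((a, 0) : SpaceTime n)
      = ∑ j, a j • ((EuclideanSpace.single j (1 : ℝ), 0) : SpaceTime n) := by
    ext k
    · simp [Prod.fst_sum, Finset.sum_apply, Pi.single_apply]
    · simp [Prod.snd_sum]
  rw [dirDeriv, ha, map_sum]
  simp only [map_smul, smul_eq_mul, spaceDeriv]

theorem IsTestFunction.continuous_timeDeriv {φ : SpaceTime n → ℝ} (hφ : IsTestFunction φ) :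
    Continuous (timeDeriv φ) := (hφ.1.dirDeriv _).continuous

theorem IsTestFunction.continuous_spaceDeriv {φ : SpaceTime n → ℝ} (hφ : IsTestFunction φ)
    (j : Fin n) : Continuous (spaceDeriv j φ) := (hφ.1.dirDeriv _).continuous

theorem IsTestFunction.hasCompactSupport_timeDeriv {φ : SpaceTime n → ℝ} (hφ : IsTestFunction φ) :
    HasCompactSupport (timeDeriv φ) := hφ.2.dirDeriv _

theorem IsTestFunction.hasCompactSupport_spaceDeriv {φ : SpaceTime n → ℝ}
    (hφ : IsTestFunction φ) (j : Fin n) : HasCompactSupport (spaceDeriv j φ) := hφ.2.dirDeriv _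

namespace IsLinearSolution

variable {v w : SpaceTime n → EuclideanSpace ℝ (Fin n)}
  {u z : SpaceTime n → EuclideanSpace ℝ (Fin n) →L[ℝ] EuclideanSpace ℝ (Fin n) →L[ℝ] ℝ}

theorem zero : IsLinearSolution (n := n) (fun _ => 0) (fun _ => 0) where
  continuous_velocity := continuous_const
  continuous_stress := continuous_const
  symm := by simp
  trace := by simp [formTrace]
  momentum := by simp
  incompressible := by simp

theorem integrable_momentum (h : IsLinearSolution v u) {φ : SpaceTime n → ℝ}
    (hφ : IsTestFunction φ) (x : EuclideanSpace ℝ (Fin n)) :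
    Integrable fun y => inner ℝ (v y) x * timeDeriv φ y
      + ∑ j, u y x (EuclideanSpace.single j 1) * spaceDeriv j φ y := by
  have hv := h.continuous_velocity
  have hu := h.continuous_stress
  refine Integrable.add ?_ (integrable_finsetSum _ fun j _ => ?_)
  · exact ((hv.inner continuous_const).mul
      hφ.continuous_timeDeriv).integrable_of_hasCompactSupport
      hφ.hasCompactSupport_timeDeriv.mul_left
  · exact (((hu.clm_apply continuous_const).clm_apply continuous_const).mul
      (hφ.continuous_spaceDeriv j)).integrable_of_hasCompactSupport
      (hφ.hasCompactSupport_spaceDeriv j).mul_left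

theorem integrable_incompressible (h : IsLinearSolution v u) {φ : SpaceTime n → ℝ}
    (hφ : IsTestFunction φ) :
    Integrable fun y => ∑ i, v y i * spaceDeriv i φ y := by
  have hv := h.continuous_velocity
  refine integrable_finsetSum _ fun j _ => ?_
  have hj : Continuous fun y => v y j := by fun_prop
  exact (hj.mul (hφ.continuous_spaceDeriv j)).integrable_of_hasCompactSupport
      (hφ.hasCompactSupport_spaceDeriv j).mul_left

theorem add (h : IsLinearSolution v u) (h' : IsLinearSolution w z) :
    IsLinearSolution (fun y => v y + w y) (fun y => u y + z y) where
  continuous_velocity := h.continuous_velocity.add h'.continuous_velocity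
  continuous_stress := h.continuous_stress.add h'.continuous_stress
  symm y a b := by simp [h.symm y a b, h'.symm y a b]
  trace y := by rw [formTrace_add, h.trace, h'.trace, add_zero]
  momentum φ hφ x := by
    have := integral_add (h.integrable_momentum hφ x) (h'.integrable_momentum hφ x)
    rw [h.momentum φ hφ x, h'.momentum φ hφ x, add_zero] at this
    rw [← this]
    congr 1
    funext y
    simp only [inner_add_left, add_apply, add_mul, Finset.sum_add_distrib]
    ring
  incompressible φ hφ := by
    have := integral_add (h.integrable_incompressible hφ) (h'.integrable_incompressible hφ)
    rw [h.incompressible φ hφ, h'.incompressible φ hφ, add_zero] at this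
    rw [← this]
    congr 1
    funext y
    simp [add_mul, Finset.sum_add_distrib]

theorem sum {ι : Type*} (s : Finset ι) {v : ι → SpaceTime n → EuclideanSpace ℝ (Fin n)}
    {u : ι → SpaceTime n → EuclideanSpace ℝ (Fin n) →L[ℝ] EuclideanSpace ℝ (Fin n) →L[ℝ] ℝ}
    (h : ∀ i ∈ s, IsLinearSolution (v i) (u i)) :
    IsLinearSolution (fun y => ∑ i ∈ s, v i y) (fun y => ∑ i ∈ s, u i y) := by
  classical
  induction s using Finset.induction_on with
  | empty => simpa using IsLinearSolution.zero
  | insert a s ha ih =>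
    simp only [Finset.sum_insert ha]
    exact (h a (Finset.mem_insert_self a s)).add
      (ih fun i hi => h i (Finset.mem_insert_of_mem hi))

end IsLinearSolution

/-! ### Potentials for the linear system. -/

/-- The velocity generated by a scalar potential `χ` in the plane spanned by `e` and `ξ`. -/
noncomputable def potentialVelocity (e ξ : EuclideanSpace ℝ (Fin n)) (χ : SpaceTime n → ℝ)
    (y : SpaceTime n) : EuclideanSpace ℝ (Fin n) :=
  (dirDeriv (ξ, 0) (dirDeriv (e, 0) (dirDeriv (e, 0) χ)) y
    + dirDeriv (ξ, 0) (dirDeriv (ξ, 0) (dirDeriv (ξ, 0) χ)) y) • e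
  - (dirDeriv (e, 0) (dirDeriv (e, 0) (dirDeriv (e, 0) χ)) y
    + dirDeriv (e, 0) (dirDeriv (ξ, 0) (dirDeriv (ξ, 0) χ)) y) • ξ

/-- The stress generated by a scalar potential `χ` in the plane spanned by `e` and `ξ`. -/
noncomputable def potentialStress (e ξ : EuclideanSpace ℝ (Fin n)) (χ : SpaceTime n → ℝ)
    (y : SpaceTime n) : EuclideanSpace ℝ (Fin n) →L[ℝ] EuclideanSpace ℝ (Fin n) →L[ℝ] ℝ :=
  (-2 * dirDeriv (e, 0) (dirDeriv (ξ, 0) (dirDeriv (0, 1) χ)) y)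
    • (tensorForm e e - tensorForm ξ ξ)
  + (dirDeriv (e, 0) (dirDeriv (e, 0) (dirDeriv (0, 1) χ)) y
    - dirDeriv (ξ, 0) (dirDeriv (ξ, 0) (dirDeriv (0, 1) χ)) y)
    • (tensorForm e ξ + tensorForm ξ e)

/-- A three-term conservation law in weak form; it serves for both momentum components and, with a
zero third field, for the divergence. -/
theorem integral_three_mul_dirDeriv {f g h φ : SpaceTime n → ℝ} (hf : ContDiff ℝ ∞ f)
    (hg : ContDiff ℝ ∞ g) (hh : ContDiff ℝ ∞ h) (hfc : HasCompactSupport f)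
    (hgc : HasCompactSupport g) (hhc : HasCompactSupport h) (hφ : IsTestFunction φ)
    (a b c : SpaceTime n) (H : ∀ y, dirDeriv a f y + dirDeriv b g y + dirDeriv c h y = 0) :
    Integrable (fun y => f y * dirDeriv a φ y + g y * dirDeriv b φ y + h y * dirDeriv c φ y) ∧
    ∫ y, (f y * dirDeriv a φ y + g y * dirDeriv b φ y + h y * dirDeriv c φ y) = 0 := by
  have I1 : ∀ {f : SpaceTime n → ℝ} (a), ContDiff ℝ ∞ f → HasCompactSupport f →
      Integrable (fun y => f y * dirDeriv a φ y) := fun a hf hc =>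
    (hf.continuous.mul (hφ.1.dirDeriv a).continuous).integrable_of_hasCompactSupport hc.mul_right
  have I2 : ∀ {f : SpaceTime n → ℝ} (a), ContDiff ℝ ∞ f → HasCompactSupport f →
      Integrable (fun y => dirDeriv a f y * φ y) := fun a hf hc =>
    ((hf.dirDeriv a).continuous.mul hφ.1.continuous).integrable_of_hasCompactSupport
      (hc.dirDeriv a).mul_right
  refine ⟨((I1 a hf hfc).add (I1 b hg hgc)).add (I1 c hh hhc), ?_⟩
  rw [integral_add (by exact (I1 a hf hfc).add (I1 b hg hgc)) (I1 c hh hhc),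
    integral_add (I1 a hf hfc) (I1 b hg hgc), integral_mul_dirDeriv hf hφ.1 hfc,
    integral_mul_dirDeriv hg hφ.1 hgc, integral_mul_dirDeriv hh hφ.1 hhc]
  have h0 : ∫ y, (dirDeriv a f y * φ y + dirDeriv b g y * φ y + dirDeriv c h y * φ y) = 0 := by
    rw [← integral_zero (SpaceTime n) ℝ]
    congr 1
    funext y
    linear_combination φ y * H y
  rw [integral_add (by exact (I2 a hf hfc).add (I2 b hg hgc)) (I2 c hh hhc),
    integral_add (I2 a hf hfc) (I2 b hg hgc)] at h0
  linarith

/-- The velocity is the rotated gradient of the Laplacian of `χ` in the `(e, ξ)` plane, hence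
divergence-free. The divergence of the stress cancels its time derivative because partial
derivatives commute. -/
theorem isLinearSolution_potential {e ξ : EuclideanSpace ℝ (Fin n)} (he : ‖e‖ = 1)
    (hξ : ‖ξ‖ = 1) (hort : inner ℝ e ξ = (0 : ℝ)) {χ : SpaceTime n → ℝ} (hχ : ContDiff ℝ ∞ χ)
    (hc : HasCompactSupport χ) :
    IsLinearSolution (potentialVelocity e ξ χ) (potentialStress e ξ χ) := by
  have sm : ∀ a b c : SpaceTime n, ContDiff ℝ ∞ (dirDeriv a (dirDeriv b (dirDeriv c χ))) :=
    fun a b c => ((hχ.dirDeriv c).dirDeriv b).dirDeriv a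
  have cs : ∀ a b c : SpaceTime n,
      HasCompactSupport (dirDeriv a (dirDeriv b (dirDeriv c χ))) :=
    fun a b c => ((hc.dirDeriv c).dirDeriv b).dirDeriv a
  set E : SpaceTime n := (e, 0) with hE
  set X : SpaceTime n := (ξ, 0) with hX
  set t : SpaceTime n := (0, 1) with ht
  set f : SpaceTime n → ℝ := fun y => dirDeriv X (dirDeriv E (dirDeriv E χ)) y
    + dirDeriv X (dirDeriv X (dirDeriv X χ)) y with hf
  set g : SpaceTime n → ℝ := fun y => (-1) * (dirDeriv E (dirDeriv E (dirDeriv E χ)) y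
    + dirDeriv E (dirDeriv X (dirDeriv X χ)) y) with hg
  set a : SpaceTime n → ℝ := fun y => (-2) * dirDeriv E (dirDeriv X (dirDeriv t χ)) y with ha
  set b : SpaceTime n → ℝ := fun y => dirDeriv E (dirDeriv E (dirDeriv t χ)) y
    - dirDeriv X (dirDeriv X (dirDeriv t χ)) y with hb
  -- The coefficient of `ξ ⊗ ξ`, namely `-a`, named apart so that the `ξ` component has the
  -- three-term shape.
  set a' : SpaceTime n → ℝ := fun y => 2 * dirDeriv E (dirDeriv X (dirDeriv t χ)) y with ha'
  have fs : ContDiff ℝ ∞ f := (sm _ _ _).add (sm _ _ _)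
  have gs : ContDiff ℝ ∞ g := contDiff_const.mul ((sm _ _ _).add (sm _ _ _))
  have as : ContDiff ℝ ∞ a := contDiff_const.mul (sm _ _ _)
  have as' : ContDiff ℝ ∞ a' := contDiff_const.mul (sm _ _ _)
  have bs : ContDiff ℝ ∞ b := (sm _ _ _).sub (sm _ _ _)
  have fc : HasCompactSupport f := (cs _ _ _).add (cs _ _ _)
  have gc : HasCompactSupport g := ((cs _ _ _).add (cs _ _ _)).mul_left
  have ac : HasCompactSupport a := (cs _ _ _).mul_left
  have ac' : HasCompactSupport a' := (cs _ _ _).mul_left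
  have bc : HasCompactSupport b := (cs _ _ _).sub (cs _ _ _)
  have hv : ∀ y, potentialVelocity e ξ χ y = f y • e + g y • ξ := by
    intro y
    simp only [potentialVelocity, hf, hg, neg_one_mul, neg_smul, sub_eq_add_neg]
    rfl
  have hu : ∀ y, potentialStress e ξ χ y = a y • (tensorForm e e - tensorForm ξ ξ)
      + b y • (tensorForm e ξ + tensorForm ξ e) := fun y => rfl
  have df : ∀ d, dirDeriv d f = fun y => dirDeriv d (dirDeriv X (dirDeriv E (dirDeriv E χ))) y
      + dirDeriv d (dirDeriv X (dirDeriv X (dirDeriv X χ))) y :=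
    fun d => dirDeriv_add (sm _ _ _) (sm _ _ _) d
  have dg : ∀ d, dirDeriv d g = fun y =>
      (-1) * (dirDeriv d (dirDeriv E (dirDeriv E (dirDeriv E χ))) y
      + dirDeriv d (dirDeriv E (dirDeriv X (dirDeriv X χ))) y) := by
    intro d
    rw [hg, dirDeriv_const_mul ((sm _ _ _).add (sm _ _ _)), dirDeriv_add (sm _ _ _) (sm _ _ _)]
  have da : ∀ d, dirDeriv d a = fun y =>
      (-2) * dirDeriv d (dirDeriv E (dirDeriv X (dirDeriv t χ))) y :=
    fun d => dirDeriv_const_mul (sm _ _ _) _ d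
  have da' : ∀ d, dirDeriv d a' = fun y =>
      2 * dirDeriv d (dirDeriv E (dirDeriv X (dirDeriv t χ))) y :=
    fun d => dirDeriv_const_mul (sm _ _ _) _ d
  have db : ∀ d, dirDeriv d b = fun y => dirDeriv d (dirDeriv E (dirDeriv E (dirDeriv t χ))) y
      - dirDeriv d (dirDeriv X (dirDeriv X (dirDeriv t χ))) y :=
    fun d => dirDeriv_sub (sm _ _ _) (sm _ _ _) d
  have pull : ∀ p q r : SpaceTime n, dirDeriv t (dirDeriv p (dirDeriv q (dirDeriv r χ)))
      = dirDeriv p (dirDeriv q (dirDeriv r (dirDeriv t χ))) := by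
    intro p q r
    rw [dirDeriv_comm ((hχ.dirDeriv r).dirDeriv q), dirDeriv_comm (hχ.dirDeriv r),
      dirDeriv_comm hχ]
  have ts : ContDiff ℝ ∞ (dirDeriv t χ) := hχ.dirDeriv t
  have sw : dirDeriv E (dirDeriv E (dirDeriv X (dirDeriv t χ)))
      = dirDeriv X (dirDeriv E (dirDeriv E (dirDeriv t χ))) := by
    rw [dirDeriv_comm ts E X, dirDeriv_comm (ts.dirDeriv E) E X]
  have sw' : dirDeriv E (dirDeriv X (dirDeriv X (dirDeriv t χ)))
      = dirDeriv X (dirDeriv E (dirDeriv X (dirDeriv t χ))) :=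
    dirDeriv_comm (ts.dirDeriv X) E X
  have P1 : ∀ y, dirDeriv t f y + dirDeriv E a y + dirDeriv X b y = 0 := by
    intro y
    rw [df, da, db]
    simp only [pull, sw]
    ring
  have P2 : ∀ y, dirDeriv t g y + dirDeriv X a' y + dirDeriv E b y = 0 := by
    intro y
    rw [dg, da', db]
    simp only [pull, sw']
    ring
  have P3 : ∀ y, dirDeriv E f y + dirDeriv X g y + dirDeriv t (fun _ => 0) y = 0 := by
    intro y
    rw [df, dg, dirDeriv_zero, dirDeriv_comm ((hχ.dirDeriv E).dirDeriv E) E X,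
      dirDeriv_comm ((hχ.dirDeriv X).dirDeriv X) E X]
    ring
  have hev : ∀ (c : EuclideanSpace ℝ (Fin n)) (φ : SpaceTime n → ℝ) (y : SpaceTime n),
      ∑ j, inner ℝ c (EuclideanSpace.single j (1 : ℝ)) * spaceDeriv j φ y
        = dirDeriv (c, 0) φ y := by
    intro c φ y
    simp only [inner_single_one]
    exact sum_mul_spaceDeriv c φ y
  refine ⟨?_, ?_, ?_, ?_, ?_, ?_⟩
  · rw [funext hv]
    exact (fs.continuous.smul continuous_const).add (gs.continuous.smul continuous_const)
  · rw [funext hu]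
    exact (as.continuous.smul continuous_const).add (bs.continuous.smul continuous_const)
  · intro y p q
    simp only [hu, add_apply, sub_apply, smul_apply, tensorForm_apply, smul_eq_mul]
    ring
  · intro y
    have hneg : tensorForm e e - tensorForm ξ ξ
        = tensorForm e e + (-1 : ℝ) • tensorForm ξ ξ := by
      rw [neg_one_smul]
      exact sub_eq_add_neg _ _
    rw [hu, hneg]
    simp only [formTrace_add, formTrace_smul, formTrace_tensorForm, real_inner_self_eq_norm_sq, he,
      hξ, hort, real_inner_comm e ξ]
    ring
  · intro φ hφ x
    obtain ⟨i1, h1⟩ := integral_three_mul_dirDeriv fs as bs fc ac bc hφ t E X P1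
    obtain ⟨i2, h2⟩ := integral_three_mul_dirDeriv gs as' bs gc ac' bc hφ t X E P2
    have h3 := integral_add (i1.const_mul (inner ℝ e x)) (i2.const_mul (inner ℝ ξ x))
    rw [integral_const_mul, integral_const_mul, h1, h2] at h3
    simp only [mul_zero, add_zero] at h3
    rw [← h3]
    congr 1
    funext y
    have hz : ∑ j, potentialStress e ξ χ y x (EuclideanSpace.single j 1) * spaceDeriv j φ y
        = (a y * inner ℝ e x + b y * inner ℝ ξ x) * dirDeriv E φ y
          + (b y * inner ℝ e x - a y * inner ℝ ξ x) * dirDeriv X φ y := by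
      rw [hE, hX, ← hev e φ y, ← hev ξ φ y, Finset.mul_sum, Finset.mul_sum,
        ← Finset.sum_add_distrib]
      refine Finset.sum_congr rfl fun j _ => ?_
      simp only [hu, add_apply, sub_apply, smul_apply, tensorForm_apply, smul_eq_mul]
      ring
    rw [hz, hv, timeDeriv_eq_dirDeriv, ← ht, inner_add_left, real_inner_smul_left,
      real_inner_smul_left]
    simp only [ha, ha']
    ring
  · intro φ hφ
    obtain ⟨-, h1⟩ := integral_three_mul_dirDeriv fs gs (contDiff_const (c := (0 : ℝ))) fc gc
      HasCompactSupport.zero hφ E X t P3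
    rw [← h1]
    congr 1
    funext y
    rw [hE, hX, ← sum_mul_spaceDeriv e φ y, ← sum_mul_spaceDeriv ξ φ y, zero_mul, add_zero,
      Finset.mul_sum, Finset.mul_sum, ← Finset.sum_add_distrib]
    refine Finset.sum_congr rfl fun j _ => ?_
    simp only [hv, PiLp.add_apply, PiLp.smul_apply, smul_eq_mul]
    ring

end LinearSystem

/-! ### Localized plane waves -/

section LocalizedWave

set_option synthInstance.maxHeartbeats 200000

variable {n : ℕ}

/-- The phase `(x, t) ↦ ξ · x - β t`. -/
noncomputable def wavePhase (ξ : EuclideanSpace ℝ (Fin n)) (β : ℝ) : StrongDual ℝ (SpaceTime n) :=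
  (innerSL ℝ ξ).comp (ContinuousLinearMap.fst ℝ (EuclideanSpace ℝ (Fin n)) ℝ)
    - β • ContinuousLinearMap.snd ℝ (EuclideanSpace ℝ (Fin n)) ℝ

theorem wavePhase_apply (ξ : EuclideanSpace ℝ (Fin n)) (β : ℝ) (y : SpaceTime n) :
    wavePhase ξ β y = inner ℝ ξ y.1 - β * y.2 := by
  simp [wavePhase]

theorem wavePhase_ne_zero {ξ : EuclideanSpace ℝ (Fin n)} (hξ : ‖ξ‖ = 1) (β : ℝ) :
    wavePhase ξ β ≠ 0 := by
  intro h
  have h1 := wavePhase_apply ξ β (ξ, 0)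
  rw [h] at h1
  simp [hξ] at h1

/-- The phase has derivative `0` along `e`, `1` along `ξ` and `-β` in time. To leading order only
`∂_ξ³` survives in the velocity and `∂_ξ² ∂ₜ` in the stress, which gives exactly the plane wave `(e,
β (e ⊗ ξ + ξ ⊗ e))`. -/
theorem exists_bound_potential_wave {e ξ : EuclideanSpace ℝ (Fin n)} (he : ‖e‖ = 1)
    (hξ : ‖ξ‖ = 1) (hort : inner ℝ e ξ = (0 : ℝ)) (β : ℝ) {φ : SpaceTime n → ℝ}
    (hφ : ContDiff ℝ ∞ φ) (hc : HasCompactSupport φ) :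
    ∃ C : ℝ, ∀ N : ℝ, 1 ≤ N → ∀ y,
      ‖potentialVelocity e ξ (wavePotential φ (wavePhase ξ β) N) y
        - (φ y * Real.cos (N * wavePhase ξ β y)) • e‖ ≤ C / N ∧
      ‖potentialStress e ξ (wavePotential φ (wavePhase ξ β) N) y
        - (φ y * Real.cos (N * wavePhase ξ β y) * β) • (tensorForm e ξ + tensorForm ξ e)‖
        ≤ C / N := by
  set l := wavePhase ξ β
  have le : l (e, 0) = 0 := by simp [l, wavePhase_apply, real_inner_comm, hort]
  have lx : l (ξ, 0) = 1 := by simp [l, wavePhase_apply, hξ]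
  have lt : l (0, 1) = -β := by simp [l, wavePhase_apply]
  obtain ⟨C1, h1⟩ := exists_bound_dirDeriv_wavePotential hφ hc l (ξ, 0) (e, 0) (e, 0)
  obtain ⟨C2, h2⟩ := exists_bound_dirDeriv_wavePotential hφ hc l (ξ, 0) (ξ, 0) (ξ, 0)
  obtain ⟨C3, h3⟩ := exists_bound_dirDeriv_wavePotential hφ hc l (e, 0) (e, 0) (e, 0)
  obtain ⟨C4, h4⟩ := exists_bound_dirDeriv_wavePotential hφ hc l (e, 0) (ξ, 0) (ξ, 0)
  obtain ⟨C5, h5⟩ := exists_bound_dirDeriv_wavePotential hφ hc l (e, 0) (ξ, 0) (0, 1)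
  obtain ⟨C6, h6⟩ := exists_bound_dirDeriv_wavePotential hφ hc l (e, 0) (e, 0) (0, 1)
  obtain ⟨C7, h7⟩ := exists_bound_dirDeriv_wavePotential hφ hc l (ξ, 0) (ξ, 0) (0, 1)
  set K1 := ‖tensorForm e e - tensorForm ξ ξ‖
  set K2 := ‖tensorForm e ξ + tensorForm ξ e‖
  refine ⟨max (C1 + C2 + (C3 + C4)) (2 * C5 * K1 + (C6 + C7) * K2), fun N hN y => ?_⟩
  have hN0 : 0 < N := by linarith
  specialize h1 N hN y
  specialize h2 N hN y
  specialize h3 N hN y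
  specialize h4 N hN y
  specialize h5 N hN y
  specialize h6 N hN y
  specialize h7 N hN y
  simp only [le, lx, lt, zero_mul, mul_zero, sub_zero, one_mul] at h1 h2 h3 h4 h5 h6 h7
  set k := φ y * Real.cos (N * l y)
  constructor
  · have hd : potentialVelocity e ξ (wavePotential φ l N) y - k • e
        = (dirDeriv (ξ, 0) (dirDeriv (e, 0) (dirDeriv (e, 0) (wavePotential φ l N))) y
          + (dirDeriv (ξ, 0) (dirDeriv (ξ, 0) (dirDeriv (ξ, 0) (wavePotential φ l N))) y - k)) • e
        - (dirDeriv (e, 0) (dirDeriv (e, 0) (dirDeriv (e, 0) (wavePotential φ l N))) y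
          + dirDeriv (e, 0) (dirDeriv (ξ, 0) (dirDeriv (ξ, 0) (wavePotential φ l N))) y) • ξ := by
      simp only [potentialVelocity]
      module
    rw [hd]
    refine (norm_sub_le _ _).trans ?_
    rw [norm_smul, norm_smul, he, hξ, mul_one, mul_one, Real.norm_eq_abs, Real.norm_eq_abs]
    calc _ ≤ (C1 / N + C2 / N) + (C3 / N + C4 / N) :=
          add_le_add ((abs_add_le _ _).trans (add_le_add h1 h2))
            ((abs_add_le _ _).trans (add_le_add h3 h4))
      _ = (C1 + C2 + (C3 + C4)) / N := by ring
      _ ≤ _ := by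
          gcongr
          exact le_max_left _ _
  · have hd : potentialStress e ξ (wavePotential φ l N) y
          - (k * β) • (tensorForm e ξ + tensorForm ξ e)
        = (-2 * dirDeriv (e, 0) (dirDeriv (ξ, 0) (dirDeriv (0, 1) (wavePotential φ l N))) y)
            • (tensorForm e e - tensorForm ξ ξ)
          + (dirDeriv (e, 0) (dirDeriv (e, 0) (dirDeriv (0, 1) (wavePotential φ l N))) y
            - (dirDeriv (ξ, 0) (dirDeriv (ξ, 0) (dirDeriv (0, 1) (wavePotential φ l N))) y
              - -β * k)) • (tensorForm e ξ + tensorForm ξ e) := by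
      simp only [potentialStress]
      module
    rw [hd]
    refine (norm_add_le _ _).trans ?_
    rw [norm_smul, norm_smul, Real.norm_eq_abs, Real.norm_eq_abs, abs_mul, abs_neg, abs_two]
    calc _ ≤ 2 * (C5 / N) * K1 + (C6 / N + C7 / N) * K2 := by
          gcongr
          exact (abs_sub _ _).trans (add_le_add h6 h7)
      _ = (2 * C5 * K1 + (C6 + C7) * K2) / N := by ring
      _ ≤ _ := by
          gcongr
          exact le_max_right _ _

theorem potential_wave_eq_zero (e ξ : EuclideanSpace ℝ (Fin n)) (φ : SpaceTime n → ℝ)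
    (l : StrongDual ℝ (SpaceTime n)) (N : ℝ) {y : SpaceTime n} (hy : y ∉ tsupport φ) :
    potentialVelocity e ξ (wavePotential φ l N) y = 0 ∧
      potentialStress e ξ (wavePotential φ l N) y = 0 := by
  have h : ∀ a b c : SpaceTime n,
      dirDeriv a (dirDeriv b (dirDeriv c (wavePotential φ l N))) y = 0 := by
    intro a b c
    refine dirDeriv_eq_zero_of_notMem_tsupport (fun h => hy ?_) a
    exact tsupport_wavePotential_subset φ l N
      (tsupport_dirDeriv_subset _ _ (tsupport_dirDeriv_subset _ _ h))
  constructor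
  · simp [potentialVelocity, h]
  · simp only [potentialStress, h, mul_zero, sub_zero]
    rw [zero_smul, zero_smul, add_zero]

variable {l : StrongDual ℝ (SpaceTime n)} {φ : SpaceTime n → ℝ} {e : EuclideanSpace ℝ (Fin n)}
  {w : ℝ → SpaceTime n → EuclideanSpace ℝ (Fin n)} {C : ℝ}

/-- Fields asymptotic to a plane wave of high frequency are almost orthogonal to a fixed field. -/
theorem tendsto_integral_inner_wave (hl : l ≠ 0) (hφ : Continuous φ)
    (hw : ∀ N, Continuous (w N))
    (hC : ∀ N : ℝ, 1 ≤ N → ∀ y, ‖w N y - (φ y * Real.cos (N * l y)) • e‖ ≤ C / N)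
    {g : SpaceTime n → EuclideanSpace ℝ (Fin n)} (hg : Continuous g)
    (hgc : HasCompactSupport g) :
    Filter.Tendsto (fun N => ∫ y, inner ℝ (g y) (w N y)) Filter.atTop (nhds (0 : ℝ)) := by
  have hig : Integrable fun y => inner ℝ (g y) e * φ y := by
    refine ((hg.inner continuous_const).mul hφ).integrable_of_hasCompactSupport ?_
    refine HasCompactSupport.mul_right (hgc.mono fun y hy => ?_)
    contrapose! hy
    have : g y = 0 := by simpa using hy
    simp [this]
  have h1 := tendsto_integral_mul_cos hig hl
  have h2 : Filter.Tendsto (fun N : ℝ => (∫ y, inner ℝ (g y) (w N y))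
      - ∫ y, inner ℝ (g y) e * φ y * Real.cos (N * l y)) Filter.atTop (nhds (0 : ℝ)) := by
    have hlim : Filter.Tendsto (fun N : ℝ => (C * ∫ y, ‖g y‖) / N) Filter.atTop (nhds 0) :=
      tendsto_const_nhds.div_atTop Filter.tendsto_id
    refine squeeze_zero_norm' ?_ hlim
    filter_upwards [Filter.eventually_ge_atTop 1] with N hN
    have i1 : Integrable fun y => (inner ℝ (g y) (w N y) : ℝ) := by
      refine (hg.inner (hw N)).integrable_of_hasCompactSupport (hgc.mono fun y hy => ?_)
      contrapose! hy
      have : g y = 0 := by simpa using hy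
      simp [this]
    have i2 : Integrable fun y => inner ℝ (g y) e * φ y * Real.cos (N * l y) := by
      refine hig.mul_bdd (c := 1) ?_ (Filter.Eventually.of_forall fun y => ?_)
      · exact Continuous.aestronglyMeasurable (by fun_prop)
      · exact Real.abs_cos_le_one _
    rw [← integral_sub i1 i2]
    have hb : ∀ y, ‖(inner ℝ (g y) (w N y) : ℝ) - inner ℝ (g y) e * φ y * Real.cos (N * l y)‖
        ≤ C / N * ‖g y‖ := by
      intro y
      have : (inner ℝ (g y) (w N y) : ℝ) - inner ℝ (g y) e * φ y * Real.cos (N * l y)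
          = inner ℝ (g y) (w N y - (φ y * Real.cos (N * l y)) • e) := by
        rw [inner_sub_right, inner_smul_right]
        ring
      rw [this, mul_comm (C / N)]
      exact (norm_inner_le_norm _ _).trans
        (mul_le_mul_of_nonneg_left (hC N hN y) (norm_nonneg _))
    refine (norm_integral_le_of_norm_le ?_ (Filter.Eventually.of_forall hb)).trans ?_
    · exact ((hg.norm.integrable_of_hasCompactSupport hgc.norm)).const_mul _
    · rw [integral_const_mul]
      exact le_of_eq (by ring)
  simpa using h2.add h1

/-- The energy of a plane wave of high frequency is about half the energy of its amplitude. -/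
theorem eventually_energy_wave (hl : l ≠ 0) (hφ : Continuous φ) (hφc : HasCompactSupport φ)
    (he : ‖e‖ = 1) (hw : ∀ N, Continuous (w N)) (hwc : ∀ N, HasCompactSupport (w N))
    (hC : ∀ N : ℝ, 1 ≤ N → ∀ y, ‖w N y - (φ y * Real.cos (N * l y)) • e‖ ≤ C / N)
    (hpos : 0 < ∫ y, φ y ^ 2) :
    ∀ᶠ N in Filter.atTop, 1 / 4 * ∫ y, φ y ^ 2 ≤ ∫ y, ‖w N y‖ ^ 2 := by
  have hsq : Integrable fun y => φ y ^ 2 :=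
    (hφ.pow 2).integrable_of_hasCompactSupport (by
      simpa only [sq] using hφc.mul_right)
  have habs : Integrable fun y => |φ y| :=
    hφ.abs.integrable_of_hasCompactSupport hφc.norm
  -- The doubled frequency comes from `cos² = (1 + cos 2·) / 2`; the energy is thus about `1/2 ∫
  -- φ²`, and `1/4` leaves room for the errors.
  have h1 := tendsto_integral_mul_cos hsq (l := (2 : ℝ) • l) (smul_ne_zero two_ne_zero hl)
  have h2 : Filter.Tendsto (fun N : ℝ => 1 / 2 * (∫ y, φ y ^ 2)
      + 1 / 2 * (∫ y, φ y ^ 2 * Real.cos (N * ((2 : ℝ) • l) y))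
      - (2 * C * ∫ y, |φ y|) / N) Filter.atTop
      (nhds (1 / 2 * (∫ y, φ y ^ 2) + 1 / 2 * 0 - 0)) :=
    (tendsto_const_nhds.add (h1.const_mul _)).sub
      (tendsto_const_nhds.div_atTop Filter.tendsto_id)
  have h3 := h2.eventually_const_lt (u := 1 / 4 * ∫ y, φ y ^ 2) (by linarith)
  filter_upwards [h3, Filter.eventually_ge_atTop 1] with N hN hN1
  refine hN.le.trans ?_
  have i2 : Integrable fun y => φ y ^ 2 * Real.cos (N * ((2 : ℝ) • l) y) := by
    refine hsq.mul_bdd (c := 1) ?_ (Filter.Eventually.of_forall fun y => ?_)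
    · exact Continuous.aestronglyMeasurable (by fun_prop)
    · exact Real.abs_cos_le_one _
  have i3 : Integrable fun y => ‖w N y‖ ^ 2 :=
    ((hw N).norm.pow 2).integrable_of_hasCompactSupport (by
      simpa only [sq] using (hwc N).norm.mul_right)
  have i4 : Integrable fun y =>
      1 / 2 * φ y ^ 2 + 1 / 2 * (φ y ^ 2 * Real.cos (N * ((2 : ℝ) • l) y)) :=
    (hsq.const_mul _).add (i2.const_mul _)
  have e1 : 1 / 2 * (∫ y, φ y ^ 2)
      + 1 / 2 * (∫ y, φ y ^ 2 * Real.cos (N * ((2 : ℝ) • l) y)) - (2 * C * ∫ y, |φ y|) / N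
      = ∫ y, (1 / 2 * φ y ^ 2 + 1 / 2 * (φ y ^ 2 * Real.cos (N * ((2 : ℝ) • l) y))
        - 2 * C / N * |φ y|) := by
    rw [integral_sub i4 (habs.const_mul _),
      integral_add (hsq.const_mul _) (i2.const_mul _), integral_const_mul, integral_const_mul,
      integral_const_mul]
    ring
  rw [e1]
  refine integral_mono (i4.sub (habs.const_mul _)) i3
    fun y => ?_
  set m := (φ y * Real.cos (N * l y)) • e with hm
  have hmn : ‖m‖ = |φ y * Real.cos (N * l y)| := by
    rw [hm, norm_smul, he, mul_one, Real.norm_eq_abs]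
  have hm1 : ‖m‖ ^ 2 = 1 / 2 * φ y ^ 2 + 1 / 2 * (φ y ^ 2 * Real.cos (N * ((2 : ℝ) • l) y)) := by
    rw [hmn, sq_abs, mul_pow, Real.cos_sq]
    have : 2 * (N * l y) = N * ((2 : ℝ) • l) y := by
      simp
      ring
    rw [this]
    ring
  have hm2 : ‖m‖ ≤ |φ y| := by
    rw [hmn, abs_mul]
    exact mul_le_of_le_one_right (abs_nonneg _) (Real.abs_cos_le_one _)
  have hd := hC N hN1 y
  have h4 : ‖m‖ - C / N ≤ ‖w N y‖ := by
    have := norm_sub_norm_le m (w N y)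
    rw [norm_sub_rev] at this
    linarith
  have hCN : 0 ≤ C / N := (norm_nonneg _).trans hd
  -- If `‖m‖ < C / N`, the left side is nonpositive; otherwise square `h4`.
  have h5 : ‖m‖ ^ 2 - 2 * ‖m‖ * (C / N) ≤ ‖w N y‖ ^ 2 := by
    by_cases hle : 0 ≤ ‖m‖ - C / N
    · nlinarith
    · nlinarith [norm_nonneg m, sq_nonneg ‖w N y‖]
  rw [← hm1]
  have h6 : ‖m‖ * (C / N) ≤ |φ y| * (C / N) := by gcongr
  have h7 : 2 * C / N * |φ y| = 2 * (|φ y| * (C / N)) := by ring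
  show ‖m‖ ^ 2 - 2 * C / N * |φ y| ≤ ‖w N y‖ ^ 2
  linarith

end LocalizedWave

/-! ### Strict subsolutions and their local perturbation -/

section Subsolution

set_option synthInstance.maxHeartbeats 200000

variable {n : ℕ}

/-- A solution of the linear system, supported in the unit ball of space-time, whose defect form
is uniformly positive. -/
structure IsStrictSubsolution (v : SpaceTime n → EuclideanSpace ℝ (Fin n))
    (u : SpaceTime n → EuclideanSpace ℝ (Fin n) →L[ℝ] EuclideanSpace ℝ (Fin n) →L[ℝ] ℝ) :
    Prop extends IsLinearSolution v u where
  eq_zero : ∀ y, y ∉ Metric.ball (0 : SpaceTime n) 1 → v y = 0 ∧ u y = 0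
  exists_pos : ∃ c : ℝ, 0 < c ∧ ∀ y x, c * ‖x‖ ^ 2 ≤ defectForm (v y) (u y) x

namespace IsStrictSubsolution

variable {v : SpaceTime n → EuclideanSpace ℝ (Fin n)}
  {u : SpaceTime n → EuclideanSpace ℝ (Fin n) →L[ℝ] EuclideanSpace ℝ (Fin n) →L[ℝ] ℝ}

theorem zero (hn : n ≠ 0) : IsStrictSubsolution (n := n) (fun _ => 0) (fun _ => 0) where
  toIsLinearSolution := IsLinearSolution.zero
  eq_zero := by simp
  exists_pos := by
    have : (0 : ℝ) < n := by exact_mod_cast Nat.pos_of_ne_zero hn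
    refine ⟨(n : ℝ)⁻¹, by positivity, fun y x => ?_⟩
    simp [defectForm]
    exact le_of_eq (by ring)

theorem defectForm_nonneg (h : IsStrictSubsolution v u) (y : SpaceTime n)
    (x : EuclideanSpace ℝ (Fin n)) : 0 ≤ defectForm (v y) (u y) x := by
  obtain ⟨c, hc, hcx⟩ := h.exists_pos
  exact le_trans (by positivity) (hcx y x)

/-- The trace `1 - ‖v‖ ^ 2` of the defect is at least `n * c > 0`. -/
theorem norm_lt_one (h : IsStrictSubsolution v u) (hn : n ≠ 0) (y : SpaceTime n) :
    ‖v y‖ < 1 := by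
  obtain ⟨c, hc, hcx⟩ := h.exists_pos
  have h1 := sum_defectForm_single (v := v y) hn (h.trace y)
  have h2 : ∑ i : Fin n, c ≤ 1 - ‖v y‖ ^ 2 := by
    rw [← h1]
    refine Finset.sum_le_sum fun i _ => ?_
    simpa using hcx y (EuclideanSpace.single i 1)
  have hn' : (0 : ℝ) < n := by exact_mod_cast Nat.pos_of_ne_zero hn
  have h3 : 0 < n * c := by positivity
  simp at h2
  nlinarith [norm_nonneg (v y)]

theorem hasCompactSupport_velocity (h : IsStrictSubsolution v u) : HasCompactSupport v :=
  HasCompactSupport.intro (isCompact_closedBall (0 : SpaceTime n) 1) fun y hy =>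
    (h.eq_zero y fun hb => hy (Metric.ball_subset_closedBall hb)).1

end IsStrictSubsolution

/-- The proportion of the squared defect that a perturbation turns into kinetic energy. -/
noncomputable def gainConst (n : ℕ) : ℝ := 1 / (256 * (n : ℝ) ^ 2 * 2 ^ (n + 1))

theorem gainConst_pos {n : ℕ} (hn : n ≠ 0) : 0 < gainConst n := by
  have : (0 : ℝ) < n := by exact_mod_cast Nat.pos_of_ne_zero hn
  unfold gainConst
  positivity

/-- The exponent is the dimension of space-time; only scaling of Haar measure enters, so the product
norm is harmless. -/
theorem measureReal_closedBall_half (y : SpaceTime n) {r : ℝ} (hr : 0 ≤ r) :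
    volume.real (Metric.closedBall y r)
      = 2 ^ (n + 1) * volume.real (Metric.closedBall y (r / 2)) := by
  have hd : Module.finrank ℝ (SpaceTime n) = n + 1 := by simp
  rw [measureReal_def, measureReal_def, Measure.addHaar_closedBall _ _ hr,
    Measure.addHaar_closedBall _ _ (by positivity), hd, ENNReal.toReal_mul, ENNReal.toReal_mul,
    ENNReal.toReal_ofReal (by positivity), ENNReal.toReal_ofReal (by positivity), div_pow]
  field_simp

/-- Around every point, a strict subsolution can be perturbed inside all small balls, gaining a
fixed proportion of the squared defect while being almost orthogonal to given fields. -/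
theorem exists_local_perturbation (hn : 2 ≤ n)
    {v : SpaceTime n → EuclideanSpace ℝ (Fin n)}
    {u : SpaceTime n → EuclideanSpace ℝ (Fin n) →L[ℝ] EuclideanSpace ℝ (Fin n) →L[ℝ] ℝ}
    (h : IsStrictSubsolution v u) {c : ℝ} (hc : 0 < c)
    (hcx : ∀ y x, c * ‖x‖ ^ 2 ≤ defectForm (v y) (u y) x) (y₀ : SpaceTime n) :
    ∃ R > 0, ∀ r, 0 < r → r < R →
      ∀ G : Set (SpaceTime n → EuclideanSpace ℝ (Fin n)), G.Finite →
      (∀ g ∈ G, Continuous g ∧ HasCompactSupport g) → ∀ ε > 0,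
      ∃ (w : SpaceTime n → EuclideanSpace ℝ (Fin n))
        (z : SpaceTime n → EuclideanSpace ℝ (Fin n) →L[ℝ] EuclideanSpace ℝ (Fin n) →L[ℝ] ℝ),
        IsLinearSolution w z ∧
        (∀ y, y ∉ Metric.closedBall y₀ r → w y = 0 ∧ z y = 0) ∧
        (∀ y ∈ Metric.closedBall y₀ r, ∀ x,
          c / 8 * ‖x‖ ^ 2 ≤ defectForm (v y + w y) (u y + z y) x) ∧
        gainConst n * (∫ y in Metric.closedBall y₀ r, (1 - ‖v y‖ ^ 2) ^ 2) ≤ ∫ y, ‖w y‖ ^ 2 ∧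
        ∀ g ∈ G, |∫ y, inner ℝ (g y) (w y)| ≤ ε := by
  have hn0 : n ≠ 0 := by omega
  have hnR : (2 : ℝ) ≤ n := by exact_mod_cast hn
  have hv1 := h.norm_lt_one hn0
  set T := 1 - ‖v y₀‖ ^ 2 with hT
  have hT0 : 0 < T := by nlinarith [hv1 y₀, norm_nonneg (v y₀)]
  have hT1 : T ≤ 1 := by nlinarith [norm_nonneg (v y₀)]
  obtain ⟨e, he, hκ⟩ := exists_direction hn0 (h.symm y₀) (h.trace y₀) (h.defectForm_nonneg y₀)
    (hv1 y₀)
  obtain ⟨ξ, α, β, hξ, hort, hdec⟩ := exists_orthogonal_decomposition hn (v y₀) he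
  -- The largest amplitude with `4 * s ≤ κ`, where `κ = T / n` comes from `exists_direction`.
  set s := T / (4 * n) with hs
  have hs0 : 0 < s := by positivity
  have hs1 : s ≤ 1 := by
    rw [hs, div_le_one (by positivity)]
    linarith
  have hsκ : 4 * s ≤ (1 - ‖v y₀‖ ^ 2) / n := by
    rw [← hT, hs]
    apply le_of_eq
    field_simp
  -- The wave leaves a lower bound `c / 4`; freezing the coefficients at `y₀` may cost `6 * η ≤ c /
  -- 8`.
  set η := min 1 (c / 48) with hη
  have hη0 : 0 < η := by positivity
  have hη1 : η ≤ 1 := min_le_left _ _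
  have hηc : 6 * η ≤ c / 8 := by
    have : η ≤ c / 48 := min_le_right _ _
    linarith
  have hvc := h.continuous_velocity
  have huc := h.continuous_stress
  have E1 : ∀ᶠ y in nhds y₀, ‖v y - v y₀‖ < η / 2 := by
    have h1 : Continuous fun y => ‖v y - v y₀‖ := (hvc.sub continuous_const).norm
    have := h1.tendsto y₀
    simp only [sub_self, norm_zero] at this
    exact this.eventually_lt_const (by positivity)
  have E2 : ∀ᶠ y in nhds y₀, ‖u y - u y₀‖ < η / 2 := by
    have h1 : Continuous fun y => ‖u y - u y₀‖ := (huc.sub continuous_const).norm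
    have := h1.tendsto y₀
    simp only [sub_self, norm_zero] at this
    exact this.eventually_lt_const (by positivity)
  have E3 : ∀ᶠ y in nhds y₀, 1 - ‖v y‖ ^ 2 < 2 * T := by
    have h1 : Continuous fun y => 1 - ‖v y‖ ^ 2 := continuous_const.sub (hvc.norm.pow 2)
    exact (h1.tendsto y₀).eventually_lt_const (by linarith)
  obtain ⟨R, hR, hball⟩ := Metric.eventually_nhds_iff_ball.1 (E1.and (E2.and E3))
  refine ⟨R, hR, fun r hr hrR G hG hGc ε hε => ?_⟩
  have hsub : Metric.closedBall y₀ r ⊆ Metric.ball y₀ R := Metric.closedBall_subset_ball hrR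
  let f : ContDiffBump y₀ := ⟨r / 2, r, by positivity, by linarith⟩
  set φ : SpaceTime n → ℝ := fun y => s * f y with hφ
  have hφs : ContDiff ℝ ∞ φ := contDiff_const.mul f.contDiff
  have hφc : HasCompactSupport φ := f.hasCompactSupport.mul_left
  have hφt : tsupport φ ⊆ Metric.closedBall y₀ r := by
    have h1 : tsupport φ ⊆ tsupport f := closure_mono fun y hy => by
      contrapose! hy
      have : f y = 0 := by simpa using hy
      simp [hφ, this]
    exact h1.trans (by rw [f.tsupport_eq])
  have hφ1 : ∀ y, |φ y| ≤ s := by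
    intro y
    rw [hφ, abs_mul, abs_of_pos hs0, abs_of_nonneg f.nonneg]
    exact mul_le_of_le_one_right hs0.le f.le_one
  set l := wavePhase ξ β
  have hl : l ≠ 0 := wavePhase_ne_zero hξ β
  obtain ⟨C, hC⟩ := exists_bound_potential_wave he hξ hort β hφs hφc
  set w : ℝ → SpaceTime n → EuclideanSpace ℝ (Fin n) :=
    fun N => potentialVelocity e ξ (wavePotential φ l N) with hw
  have hlin : ∀ N, IsLinearSolution (w N) (potentialStress e ξ (wavePotential φ l N)) := by
    intro N
    refine isLinearSolution_potential he hξ hort (contDiff_wavePotential hφs l N) ?_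
    exact IsCompact.of_isClosed_subset hφc (isClosed_tsupport _)
      (tsupport_wavePotential_subset φ l N)
  have hwz : ∀ N y, y ∉ Metric.closedBall y₀ r → w N y = 0 ∧
      potentialStress e ξ (wavePotential φ l N) y = 0 :=
    fun N y hy => potential_wave_eq_zero e ξ φ l N fun hy' => hy (hφt hy')
  have hwc : ∀ N, HasCompactSupport (w N) := fun N =>
    HasCompactSupport.intro (isCompact_closedBall y₀ r) fun y hy => (hwz N y hy).1
  have hint : s ^ 2 * volume.real (Metric.closedBall y₀ (r / 2)) ≤ ∫ y, φ y ^ 2 := by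
    have hi : Integrable fun y => φ y ^ 2 :=
      (hφs.continuous.pow 2).integrable_of_hasCompactSupport (by
        simpa only [sq] using hφc.mul_right)
    have h1 : ∫ y in Metric.closedBall y₀ (r / 2), φ y ^ 2 ≤ ∫ y, φ y ^ 2 :=
      setIntegral_le_integral hi (Filter.Eventually.of_forall fun y => sq_nonneg _)
    refine le_trans (le_of_eq ?_) h1
    rw [setIntegral_congr_fun (g := fun _ => s ^ 2) Metric.isClosed_closedBall.measurableSet
      (fun y hy => ?_)]
    · rw [setIntegral_const, smul_eq_mul, mul_comm]
    · simp [hφ, f.one_of_mem_closedBall hy]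
  have hvol : 0 < volume.real (Metric.closedBall y₀ (r / 2)) := by
    refine ENNReal.toReal_pos (Metric.measure_closedBall_pos _ _ (by positivity)).ne' ?_
    exact (isCompact_closedBall _ _).measure_lt_top.ne
  have hpos : 0 < ∫ y, φ y ^ 2 := lt_of_lt_of_le (by positivity) hint
  have F1 := eventually_energy_wave hl hφs.continuous hφc he
    (fun N => (hlin N).continuous_velocity) hwc (fun N hN y => (hC N hN y).1) hpos
  have F2 : ∀ᶠ N in Filter.atTop, ∀ g ∈ G, |∫ y, inner ℝ (g y) (w N y)| ≤ ε := by
    rw [Filter.eventually_all_finite hG]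
    intro g hg
    have := tendsto_integral_inner_wave hl hφs.continuous
      (fun N => (hlin N).continuous_velocity) (fun N hN y => (hC N hN y).1) (hGc g hg).1
      (hGc g hg).2
    have h2 := this.abs.eventually_le_const (u := ε) (by simpa using hε)
    exact h2
  have F3 : ∀ᶠ N : ℝ in Filter.atTop, C / N < η / 2 :=
    (tendsto_const_nhds.div_atTop Filter.tendsto_id).eventually_lt_const (by positivity)
  -- The frequency is fixed last: `C` depends on the cutoff, and the Riemann–Lebesgue threshold on
  -- `G` and `ε`.
  obtain ⟨N, hN1, hN2, hN3, hN4⟩ :=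
    (F1.and (F2.and (F3.and (Filter.eventually_ge_atTop 1)))).exists
  refine ⟨w N, potentialStress e ξ (wavePotential φ l N), hlin N, hwz N, ?_, ?_, hN2⟩
  · intro y hy x
    obtain ⟨b1, b2, -⟩ := hball y (hsub hy)
    obtain ⟨b3, b4⟩ := hC N hN4 y
    set τ := φ y * Real.cos (N * l y) with hτ
    have hτs : |τ| ≤ s := by
      rw [hτ, abs_mul]
      exact (mul_le_of_le_one_right (abs_nonneg _) (Real.abs_cos_le_one _)).trans (hφ1 y)
    have g1 := defectForm_add_wave he hort hdec (hv1 y₀).le hκ (hcx y₀) hs1 hsκ hτs x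
    have hV : ‖v y₀ + τ • e‖ ≤ 2 := by
      refine (norm_add_le _ _).trans ?_
      rw [norm_smul, he, mul_one, Real.norm_eq_abs]
      linarith [hv1 y₀]
    have hV' : ‖(v y + w N y) - (v y₀ + τ • e)‖ ≤ η := by
      have : (v y + w N y) - (v y₀ + τ • e) = (v y - v y₀) + (w N y - τ • e) := by abel
      rw [this]
      refine (norm_add_le _ _).trans ?_
      linarith
    have hU' : ‖(u y + potentialStress e ξ (wavePotential φ l N) y)
        - (u y₀ + (τ * β) • (tensorForm e ξ + tensorForm ξ e))‖ ≤ η := by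
      have : (u y + potentialStress e ξ (wavePotential φ l N) y)
        - (u y₀ + (τ * β) • (tensorForm e ξ + tensorForm ξ e)) = (u y - u y₀)
          + (potentialStress e ξ (wavePotential φ l N) y
            - (τ * β) • (tensorForm e ξ + tensorForm ξ e)) := add_sub_add_comm _ _ _ _
      rw [this]
      refine (norm_add_le _ _).trans ?_
      linarith
    have g2 := (abs_le.1 (abs_defectForm_sub_le hη1 hV hV' hU' x)).1
    have g3 : 6 * η * ‖x‖ ^ 2 ≤ c / 8 * ‖x‖ ^ 2 := by gcongr
    linarith
  · have hB : ∫ y in Metric.closedBall y₀ r, (1 - ‖v y‖ ^ 2) ^ 2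
        ≤ 4 * T ^ 2 * volume.real (Metric.closedBall y₀ r) := by
      have h1 : ∀ y ∈ Metric.closedBall y₀ r, ‖(1 - ‖v y‖ ^ 2) ^ 2‖ ≤ 4 * T ^ 2 := by
        intro y hy
        obtain ⟨-, -, b3⟩ := hball y (hsub hy)
        have : 0 ≤ 1 - ‖v y‖ ^ 2 := by nlinarith [hv1 y, norm_nonneg (v y)]
        rw [Real.norm_eq_abs, abs_of_nonneg (sq_nonneg _)]
        nlinarith
      exact (le_abs_self _).trans (norm_setIntegral_le_of_norm_le_const
        (isCompact_closedBall _ _).measure_lt_top h1)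
    have hgp := gainConst_pos hn0
    refine le_trans (mul_le_mul_of_nonneg_left hB hgp.le) (le_trans ?_ hN1)
    -- Origin of `gainConst`: the energy is at least `(1/4) (T / 4n)² |B_r| / 2^(n+1)`, the squared
    -- defect integrates to at most `4 T² |B_r|`, and the ratio of the two is `1 / (256 n²
    -- 2^(n+1))`.
    have h2 : 1 / 4 * (s ^ 2 * volume.real (Metric.closedBall y₀ (r / 2)))
        ≤ 1 / 4 * ∫ y, φ y ^ 2 := by gcongr
    refine le_trans (le_of_eq ?_) h2
    rw [measureReal_closedBall_half y₀ hr.le, gainConst, hs]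
    field_simp
    ring

end Subsolution

/-! ### Global perturbation -/

section Perturbation

set_option synthInstance.maxHeartbeats 200000

variable {n : ℕ}

/-- Besicovitch fills almost all of the unit ball with countably many disjoint closed balls of
admissible radius; a finite subfamily already carries half of the convergent sum. -/
theorem exists_disjoint_balls (R : SpaceTime n → ℝ) (hR : ∀ y, 0 < R y) {D : SpaceTime n → ℝ}
    (hD : Continuous D) (hD0 : ∀ y, 0 ≤ D y) :
    ∃ (F : Finset (SpaceTime n)) (r : SpaceTime n → ℝ),
      (∀ y ∈ F, 0 < r y ∧ r y < R y ∧ Metric.closedBall y (r y) ⊆ Metric.ball 0 1) ∧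
      (F : Set (SpaceTime n)).PairwiseDisjoint (fun y => Metric.closedBall y (r y)) ∧
      1 / 2 * (∫ y in Metric.ball (0 : SpaceTime n) 1, D y)
        ≤ ∑ x ∈ F, ∫ y in Metric.closedBall x (r x), D y := by
  set B := Metric.ball (0 : SpaceTime n) 1 with hB
  obtain ⟨t, r, htc, htB, hr, hcov, hdis⟩ :=
    Besicovitch.exists_disjoint_closedBall_covering_ae (volume : Measure (SpaceTime n))
      (fun _ => Set.univ) B
      (fun x _ δ hδ => ⟨δ / 2, trivial, by positivity, by linarith⟩)
      (fun y => min (R y) (1 - ‖y‖))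
      (fun y hy => lt_min (hR y) (by
        have : ‖y‖ < 1 := by simpa [hB] using hy
        linarith))
  have hsub : ∀ y ∈ t, Metric.closedBall y (r y) ⊆ B := by
    intro y hy a ha
    have h1 : r y < 1 - ‖y‖ := (hr y hy).2.2.trans_le (min_le_right _ _)
    have h2 : dist a y ≤ r y := ha
    rw [hB, Metric.mem_ball, dist_zero_right]
    have := norm_le_norm_add_norm_sub' a y
    rw [dist_eq_norm] at h2
    linarith
  have hint : IntegrableOn D B :=
    (hD.continuousOn.integrableOn_compact (isCompact_closedBall 0 1)).mono_set
      Metric.ball_subset_closedBall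
  have : Countable t := htc
  have hUB : (⋃ x : t, Metric.closedBall (x : SpaceTime n) (r x)) ⊆ B :=
    Set.iUnion_subset fun x => hsub x x.2
  have hsum := hasSum_integral_iUnion (μ := volume) (f := D)
    (s := fun x : t => Metric.closedBall (x : SpaceTime n) (r x))
    (fun x => Metric.isClosed_closedBall.measurableSet)
    (fun x y hxy => hdis x.2 y.2 (fun h => hxy (Subtype.ext h))) (hint.mono_set hUB)
  have heq : ∫ y in ⋃ x : t, Metric.closedBall (x : SpaceTime n) (r x), D y = ∫ y in B, D y := by
    refine setIntegral_congr_set (Filter.Eventually.set_eq ?_)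
    rw [← Set.biUnion_eq_iUnion t (fun x _ => Metric.closedBall x (r x))] at *
    have h0 := measure_eq_zero_iff_ae_notMem.1 hcov
    filter_upwards [h0] with y hy
    refine ⟨fun h => hUB h, fun h => ?_⟩
    by_contra hne
    exact hy ⟨h, hne⟩
  rw [heq] at hsum
  have hnn : 0 ≤ ∫ y in B, D y := integral_nonneg hD0
  obtain ⟨F, hF⟩ : ∃ F : Finset t, 1 / 2 * (∫ y in B, D y)
      ≤ ∑ x ∈ F, ∫ y in Metric.closedBall (x : SpaceTime n) (r x), D y := by
    -- Half the integral lies strictly below the full sum only if the integral is positive;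
    -- otherwise the empty family suffices.
    rcases hnn.eq_or_lt with h0 | h0
    · exact ⟨∅, by simp [← h0]⟩
    · exact (hsum.eventually_const_le (by linarith)).exists
  refine ⟨F.map (Function.Embedding.subtype _), r, ?_, ?_, ?_⟩
  · intro y hy
    obtain ⟨x, -, rfl⟩ := Finset.mem_map.1 hy
    exact ⟨(hr x x.2).2.1, (hr x x.2).2.2.trans_le (min_le_left _ _), hsub x x.2⟩
  · refine hdis.subset fun y hy => ?_
    obtain ⟨x, -, rfl⟩ := Finset.mem_map.1 (Finset.mem_coe.1 hy)
    exact x.2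
  · rw [Finset.sum_map]
    exact hF

/-- A strict subsolution can be perturbed so as to gain a fixed proportion of its squared defect,
almost orthogonally to given fields. -/
theorem IsStrictSubsolution.exists_perturbation (hn : 2 ≤ n)
    {v : SpaceTime n → EuclideanSpace ℝ (Fin n)}
    {u : SpaceTime n → EuclideanSpace ℝ (Fin n) →L[ℝ] EuclideanSpace ℝ (Fin n) →L[ℝ] ℝ}
    (h : IsStrictSubsolution v u)
    {G : Set (SpaceTime n → EuclideanSpace ℝ (Fin n))} (hG : G.Finite)
    (hGc : ∀ g ∈ G, Continuous g ∧ HasCompactSupport g) {ε : ℝ} (hε : 0 < ε) :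
    ∃ (v' : SpaceTime n → EuclideanSpace ℝ (Fin n))
      (u' : SpaceTime n → EuclideanSpace ℝ (Fin n) →L[ℝ] EuclideanSpace ℝ (Fin n) →L[ℝ] ℝ),
      IsStrictSubsolution v' u' ∧
      gainConst n / 2 * (∫ y in Metric.ball (0 : SpaceTime n) 1, (1 - ‖v y‖ ^ 2) ^ 2)
        ≤ ∫ y, ‖v' y - v y‖ ^ 2 ∧
      ∀ g ∈ G, |∫ y, inner ℝ (g y) (v' y - v y)| ≤ ε := by
  classical
  have hn0 : n ≠ 0 := by omega
  obtain ⟨c, hc, hcx⟩ := h.exists_pos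
  choose R hR hloc using exists_local_perturbation hn h hc hcx
  have hDc : Continuous fun y => (1 - ‖v y‖ ^ 2) ^ 2 :=
    (continuous_const.sub (h.continuous_velocity.norm.pow 2)).pow 2
  obtain ⟨F, r, hFr, hdis, hF⟩ := exists_disjoint_balls R hR hDc fun y => sq_nonneg _
  -- The error is shared among the balls; the `+ 1` covers an empty `F`.
  set ε' := ε / (F.card + 1) with hε'
  have hε'0 : 0 < ε' := by positivity
  have hex : ∀ x : SpaceTime n, ∃ (w : SpaceTime n → EuclideanSpace ℝ (Fin n))
      (z : SpaceTime n → EuclideanSpace ℝ (Fin n) →L[ℝ] EuclideanSpace ℝ (Fin n) →L[ℝ] ℝ),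
      x ∈ F → IsLinearSolution w z ∧
        (∀ y, y ∉ Metric.closedBall x (r x) → w y = 0 ∧ z y = 0) ∧
        (∀ y ∈ Metric.closedBall x (r x), ∀ a,
          c / 8 * ‖a‖ ^ 2 ≤ defectForm (v y + w y) (u y + z y) a) ∧
        gainConst n * (∫ y in Metric.closedBall x (r x), (1 - ‖v y‖ ^ 2) ^ 2)
          ≤ ∫ y, ‖w y‖ ^ 2 ∧
        ∀ g ∈ G, |∫ y, inner ℝ (g y) (w y)| ≤ ε' := by
    intro x
    by_cases hx : x ∈ F
    · obtain ⟨w, z, hwz⟩ := hloc x (r x) (hFr x hx).1 (hFr x hx).2.1 G hG hGc ε' hε'0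
      exact ⟨w, z, fun _ => hwz⟩
    · exact ⟨0, 0, fun hx' => absurd hx' hx⟩
  choose w z hwz using hex
  have hlin : IsLinearSolution (fun y => ∑ x ∈ F, w x y) (fun y => ∑ x ∈ F, z x y) :=
    IsLinearSolution.sum F fun x hx => (hwz x hx).1
  have hone : ∀ x ∈ F, ∀ y ∈ Metric.closedBall x (r x), ∀ x' ∈ F, x' ≠ x →
      w x' y = 0 ∧ z x' y = 0 := by
    intro x hx y hy x' hx' hne
    refine (hwz x' hx').2.1 y fun hy' => ?_
    exact (Set.disjoint_left.1 (hdis (Finset.mem_coe.2 hx') (Finset.mem_coe.2 hx) hne)) hy' hy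
  have hin : ∀ x ∈ F, ∀ y ∈ Metric.closedBall x (r x),
      ∑ x' ∈ F, w x' y = w x y ∧ ∑ x' ∈ F, z x' y = z x y := by
    intro x hx y hy
    constructor
    · exact Finset.sum_eq_single x (fun x' hx' hne => (hone x hx y hy x' hx' hne).1)
        (fun hx' => absurd hx hx')
    · exact Finset.sum_eq_single x (fun x' hx' hne => (hone x hx y hy x' hx' hne).2)
        (fun hx' => absurd hx hx')
  have hout : ∀ y, (∀ x ∈ F, y ∉ Metric.closedBall x (r x)) →
      ∑ x ∈ F, w x y = 0 ∧ ∑ x ∈ F, z x y = 0 := by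
    intro y hy
    exact ⟨Finset.sum_eq_zero fun x hx => ((hwz x hx).2.1 y (hy x hx)).1,
      Finset.sum_eq_zero fun x hx => ((hwz x hx).2.1 y (hy x hx)).2⟩
  have hcomp : ∀ x ∈ F, HasCompactSupport (w x) := fun x hx =>
    HasCompactSupport.intro (isCompact_closedBall x (r x)) fun y hy =>
      ((hwz x hx).2.1 y hy).1
  refine ⟨fun y => v y + ∑ x ∈ F, w x y, fun y => u y + ∑ x ∈ F, z x y,
    ⟨h.toIsLinearSolution.add hlin, ?_, ?_⟩, ?_, ?_⟩
  · intro y hy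
    have h1 := hout y fun x hx hyx => hy ((hFr x hx).2.2 hyx)
    have h2 := h.eq_zero y hy
    simp [h1.1, h1.2, h2.1, h2.2]
  · refine ⟨c / 8, by positivity, fun y a => ?_⟩
    by_cases hy : ∃ x ∈ F, y ∈ Metric.closedBall x (r x)
    · obtain ⟨x, hx, hyx⟩ := hy
      simp only [(hin x hx y hyx).1, (hin x hx y hyx).2]
      exact (hwz x hx).2.2.1 y hyx a
    · push Not at hy
      simp only [(hout y hy).1, (hout y hy).2, add_zero]
      refine le_trans ?_ (hcx y a)
      gcongr
      linarith
  · have hsq : ∀ y, ‖v y + ∑ x ∈ F, w x y - v y‖ ^ 2 = ∑ x ∈ F, ‖w x y‖ ^ 2 := by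
      intro y
      rw [add_sub_cancel_left]
      by_cases hy : ∃ x ∈ F, y ∈ Metric.closedBall x (r x)
      · obtain ⟨x, hx, hyx⟩ := hy
        rw [(hin x hx y hyx).1]
        symm
        refine Finset.sum_eq_single x (fun x' hx' hne => ?_) (fun hx' => absurd hx hx')
        simp [(hone x hx y hyx x' hx' hne).1]
      · push Not at hy
        have h0 : ∑ x ∈ F, ‖w x y‖ ^ 2 = 0 := Finset.sum_eq_zero fun x hx => by
          simp [((hwz x hx).2.1 y (hy x hx)).1]
        rw [(hout y hy).1, h0]
        simp
    simp only [hsq]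
    rw [integral_finsetSum F]
    · calc gainConst n / 2 * (∫ y in Metric.ball (0 : SpaceTime n) 1, (1 - ‖v y‖ ^ 2) ^ 2)
          = gainConst n
            * (1 / 2 * ∫ y in Metric.ball (0 : SpaceTime n) 1, (1 - ‖v y‖ ^ 2) ^ 2) := by ring
        _ ≤ gainConst n * ∑ x ∈ F, ∫ y in Metric.closedBall x (r x), (1 - ‖v y‖ ^ 2) ^ 2 :=
          mul_le_mul_of_nonneg_left hF (gainConst_pos hn0).le
        _ ≤ _ := by
          rw [Finset.mul_sum]
          exact Finset.sum_le_sum fun x hx => (hwz x hx).2.2.2.1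
    · intro x hx
      exact ((hwz x hx).1.continuous_velocity.norm.pow 2).integrable_of_hasCompactSupport (by
        simpa only [sq] using (hcomp x hx).norm.mul_right)
  · intro g hg
    simp only [add_sub_cancel_left, inner_sum]
    rw [integral_finsetSum F]
    · refine (Finset.abs_sum_le_sum_abs _ _).trans ?_
      calc ∑ x ∈ F, |∫ y, inner ℝ (g y) (w x y)| ≤ ∑ x ∈ F, ε' :=
            Finset.sum_le_sum fun x hx => (hwz x hx).2.2.2.2 g hg
        _ = F.card * ε' := by simp
        _ ≤ ε := by
            rw [hε', mul_div_assoc', div_le_iff₀ (by positivity)]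
            nlinarith
    · intro x hx
      refine ((hGc g hg).1.inner
        (hwz x hx).1.continuous_velocity).integrable_of_hasCompactSupport
          ((hcomp x hx).mono fun y hy => ?_)
      contrapose! hy
      have : w x y = 0 := by simpa using hy
      simp [this]

end Perturbation

/-! ### Iteration -/

/-- Dependent choice in which each step may depend on the finite set of all previous terms. -/
theorem exists_seq_of_finite_history {α : Type*} {P : α → Prop} {r : ℕ → Set α → α → α → Prop}
    (a₀ : α) (h₀ : P a₀)
    (h : ∀ k (S : Set α) a, S.Finite → (∀ b ∈ S, P b) → P a → ∃ b, P b ∧ r k S a b) :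
    ∃ f : ℕ → α, ∀ k, P (f k) ∧ r k (f '' Set.Iic k) (f k) (f (k + 1)) := by
  classical
  -- The state pairs the current term with the set of all terms so far, the current one included.
  let σ := {p : α × Set α // P p.1 ∧ p.2.Finite ∧ ∀ b ∈ p.2, P b}
  have step : ∀ k (s : σ), ∃ s' : σ, s'.1.2 = insert s'.1.1 s.1.2 ∧
      r k s.1.2 s.1.1 s'.1.1 := by
    rintro k ⟨⟨a, S⟩, ha, hS, hP⟩
    obtain ⟨b, hb, hr⟩ := h k S a hS hP ha
    refine ⟨⟨(b, insert b S), hb, hS.insert b, ?_⟩, rfl, hr⟩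
    intro c hc
    rcases hc with rfl | hc
    · exact hb
    · exact hP c hc
  choose next hn1 hn2 using step
  let s₀ : σ := ⟨(a₀, {a₀}), h₀, Set.finite_singleton _, by rintro b rfl; exact h₀⟩
  let F : ℕ → σ := fun k => Nat.rec s₀ next k
  have hF : ∀ k, (F k).1.2 = (fun j => (F j).1.1) '' Set.Iic k := by
    intro k
    induction k with
    | zero =>
      have : Set.Iic 0 = ({0} : Set ℕ) := by ext; simp
      rw [this, Set.image_singleton]
      rfl
    | succ k ih =>
      have h1 : (F (k + 1)).1.2 = insert (F (k + 1)).1.1 (F k).1.2 := hn1 k (F k)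
      have h2 : Set.Iic (k + 1) = insert (k + 1) (Set.Iic k) := by
        ext j
        simp only [Set.mem_Iic, Set.mem_insert_iff]
        omega
      rw [h1, ih, h2, Set.image_insert_eq]
  refine ⟨fun k => (F k).1.1, fun k => ⟨(F k).2.1, ?_⟩⟩
  have := hn2 k (F k)
  rw [hF k] at this
  exact this

/-- A bounded sequence with almost orthogonal increments is Cauchy. -/
theorem cauchySeq_of_almost_orthogonal {H : Type*} [NormedAddCommGroup H] [InnerProductSpace ℝ H]
    {x : ℕ → H} {B : ℝ} (hB : ∀ k, ‖x k‖ ≤ B)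
    (h : ∀ k, ∀ i ≤ k, |(inner ℝ (x i) (x (k + 1) - x k) : ℝ)| ≤ (1 / 2) ^ k) : CauchySeq x := by
  -- One step lowers `‖x k‖ ^ 2` by at most `2 * (1/2) ^ k`, exactly what the change of the
  -- correction `4 * (1/2) ^ k` restores.
  set a : ℕ → ℝ := fun k => ‖x k‖ ^ 2 - 4 * (1 / 2) ^ k with ha
  have hp : ∀ k : ℕ, (0 : ℝ) < (1 / 2) ^ k := fun k => by positivity
  have hmono : Monotone a := by
    refine monotone_nat_of_le_succ fun k => ?_
    have h1 := (abs_le.1 (h k k le_rfl)).1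
    have h2 : ‖x (k + 1)‖ ^ 2 = ‖x k‖ ^ 2 + 2 * inner ℝ (x k) (x (k + 1) - x k)
        + ‖x (k + 1) - x k‖ ^ 2 := by
      rw [← norm_add_sq_real, add_sub_cancel]
    simp only [ha, pow_succ]
    nlinarith [sq_nonneg ‖x (k + 1) - x k‖]
  have hbdd : BddAbove (Set.range a) := by
    refine ⟨B ^ 2, ?_⟩
    rintro _ ⟨k, rfl⟩
    have : ‖x k‖ ^ 2 ≤ B ^ 2 := by
      have := hB k
      gcongr
    simp only [ha]
    linarith [hp k]
  have hlim := tendsto_atTop_ciSup hmono hbdd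
  -- Telescoping the increments after `k`: the right side is a partial geometric sum. This is why
  -- orthogonality to all earlier terms is required.
  have hin : ∀ k m, k ≤ m →
      |(inner ℝ (x k) (x m - x k) : ℝ)| ≤ 2 * ((1 / 2) ^ k - (1 / 2) ^ m) := by
    intro k m hkm
    induction m, hkm using Nat.le_induction with
    | base => simp
    | succ m hkm ih =>
      have e : x (m + 1) - x k = (x (m + 1) - x m) + (x m - x k) := by abel
      rw [e, inner_add_right]
      refine (abs_add_le _ _).trans ?_
      have := h m k hkm
      rw [pow_succ]
      linarith
  -- The corrections match: `‖x m - x k‖ ^ 2 ≤ a m - a k ≤ sup a - a k`.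
  refine cauchySeq_of_le_tendsto_0' (fun k => Real.sqrt ((⨆ k, a k) - a k)) (fun k m hkm => ?_) ?_
  · apply Real.le_sqrt_of_sq_le
    have h1 := (abs_le.1 (hin k m hkm)).1
    have h2 : ‖x m‖ ^ 2 = ‖x k‖ ^ 2 + 2 * inner ℝ (x k) (x m - x k) + ‖x m - x k‖ ^ 2 := by
      rw [← norm_add_sq_real, add_sub_cancel]
    have h3 : a m ≤ ⨆ k, a k := le_ciSup hbdd m
    rw [dist_comm, dist_eq_norm]
    simp only [ha] at h3 ⊢
    linarith
  · have h1 := (tendsto_const_nhds (x := ⨆ k, a k)).sub hlim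
    rw [sub_self] at h1
    have h2 := (Real.continuous_sqrt.tendsto 0).comp h1
    rwa [Real.sqrt_zero] at h2

/-! ### Strong convergence of the iteration. -/

section Limit

set_option synthInstance.maxHeartbeats 200000

variable {n : ℕ}

/-- Strict subsolutions converging almost everywhere with vanishing defect. -/
theorem exists_subsolution_seq (hn : 2 ≤ n) :
    ∃ (v : ℕ → SpaceTime n → EuclideanSpace ℝ (Fin n))
      (u : ℕ → SpaceTime n → EuclideanSpace ℝ (Fin n) →L[ℝ] EuclideanSpace ℝ (Fin n) →L[ℝ] ℝ)
      (V : SpaceTime n → EuclideanSpace ℝ (Fin n)),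
      (∀ k, IsStrictSubsolution (v k) (u k)) ∧ AEStronglyMeasurable V ∧
      (∀ᵐ y, Filter.Tendsto (fun k => v k y) Filter.atTop (nhds (V y))) ∧
      Filter.Tendsto
        (fun k => ∫ y in Metric.ball (0 : SpaceTime n) 1, (1 - ‖v k y‖ ^ 2) ^ 2)
        Filter.atTop (nhds 0) := by
  have hn0 : n ≠ 0 := by omega
  obtain ⟨f, hf⟩ := exists_seq_of_finite_history
    (α := (SpaceTime n → EuclideanSpace ℝ (Fin n)) ×
      (SpaceTime n → EuclideanSpace ℝ (Fin n) →L[ℝ] EuclideanSpace ℝ (Fin n) →L[ℝ] ℝ))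
    (P := fun p => IsStrictSubsolution p.1 p.2)
    (r := fun k S a b =>
      gainConst n / 2 * (∫ y in Metric.ball (0 : SpaceTime n) 1, (1 - ‖a.1 y‖ ^ 2) ^ 2)
        ≤ ∫ y, ‖b.1 y - a.1 y‖ ^ 2 ∧
      ∀ g ∈ S, |∫ y, inner ℝ (g.1 y) (b.1 y - a.1 y)| ≤ (1 / 2 : ℝ) ^ k)
    (fun _ => 0, fun _ => 0) (IsStrictSubsolution.zero hn0)
    (by
      intro k S a hS hSP ha
      obtain ⟨v', u', h1, h2, h3⟩ := ha.exists_perturbation hn (hS.image Prod.fst)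
        (by
          rintro _ ⟨g, hg, rfl⟩
          exact ⟨(hSP g hg).continuous_velocity, (hSP g hg).hasCompactSupport_velocity⟩)
        (ε := (1 / 2 : ℝ) ^ k) (by positivity)
      exact ⟨(v', u'), h1, h2, fun g hg => h3 g.1 ⟨g, hg, rfl⟩⟩)
  have hsub := fun k => (hf k).1
  have hmem : ∀ k, MemLp (f k).1 2 volume := fun k =>
    (hsub k).continuous_velocity.memLp_of_hasCompactSupport (hsub k).hasCompactSupport_velocity
  set x : ℕ → Lp (EuclideanSpace ℝ (Fin n)) 2 (volume : Measure (SpaceTime n)) :=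
    fun k => (hmem k).toLp with hx
  have hinner : ∀ i k, (inner ℝ (x i) (x (k + 1) - x k) : ℝ)
      = ∫ y, inner ℝ ((f i).1 y) ((f (k + 1)).1 y - (f k).1 y) := by
    intro i k
    rw [hx]
    simp only
    rw [← MemLp.toLp_sub, L2.inner_def]
    refine integral_congr_ae ?_
    filter_upwards [(hmem i).coeFn_toLp, ((hmem (k + 1)).sub (hmem k)).coeFn_toLp] with y h1 h2
    rw [h1, h2]
    rfl
  have hnormsq : ∀ {g : SpaceTime n → EuclideanSpace ℝ (Fin n)} (hg : MemLp g 2 volume),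
      ‖hg.toLp‖ ^ 2 = ∫ y, ‖g y‖ ^ 2 := by
    intro g hg
    rw [← real_inner_self_eq_norm_sq, L2.inner_def]
    refine integral_congr_ae ?_
    filter_upwards [hg.coeFn_toLp] with y h1
    rw [h1, real_inner_self_eq_norm_sq]
  have hbd : ∀ k, ‖x k‖ ≤ Real.sqrt (volume.real (Metric.ball (0 : SpaceTime n) 1)) := by
    intro k
    apply Real.le_sqrt_of_sq_le
    rw [hx, hnormsq]
    have h1 : ∫ y, ‖(f k).1 y‖ ^ 2 = ∫ y in Metric.ball (0 : SpaceTime n) 1, ‖(f k).1 y‖ ^ 2 := by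
      refine (setIntegral_eq_integral_of_forall_compl_eq_zero fun y hy => ?_).symm
      simp [((hsub k).eq_zero y hy).1]
    rw [h1]
    have h2 : ∀ y ∈ Metric.ball (0 : SpaceTime n) 1, ‖‖(f k).1 y‖ ^ 2‖ ≤ 1 := by
      intro y _
      rw [Real.norm_eq_abs, abs_of_nonneg (sq_nonneg _)]
      exact pow_le_one₀ (norm_nonneg _) ((hsub k).norm_lt_one hn0 y).le
    have h3 := norm_setIntegral_le_of_norm_le_const (μ := volume) measure_ball_lt_top h2
    rw [one_mul] at h3
    exact (le_abs_self _).trans h3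
  have hcau : CauchySeq x := by
    refine cauchySeq_of_almost_orthogonal hbd fun k i hik => ?_
    rw [hinner]
    exact (hf k).2.2 (f i) ⟨i, hik, rfl⟩
  obtain ⟨X, hX⟩ := cauchySeq_tendsto_of_complete hcau
  have hgain : Filter.Tendsto
      (fun k => ∫ y in Metric.ball (0 : SpaceTime n) 1, (1 - ‖(f k).1 y‖ ^ 2) ^ 2)
      Filter.atTop (nhds 0) := by
    have hd : Filter.Tendsto (fun k => (gainConst n / 2)⁻¹ * ‖x (k + 1) - x k‖ ^ 2) Filter.atTop
        (nhds 0) := by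
      have h1 := (hX.comp (Filter.tendsto_add_atTop_nat 1)).sub hX
      rw [sub_self] at h1
      have h2 := (h1.norm.pow 2).const_mul (gainConst n / 2)⁻¹
      simpa using h2
    -- The gain inequality read backwards: the defect is bounded by the increment, which vanishes
    -- for a convergent sequence.
    refine squeeze_zero (fun k => integral_nonneg fun y => sq_nonneg _) (fun k => ?_) hd
    have hg := gainConst_pos hn0
    rw [← div_eq_inv_mul, le_div_iff₀ (by positivity), mul_comm]
    refine (hf k).2.1.trans (le_of_eq ?_)
    rw [hx]
    simp only
    rw [← MemLp.toLp_sub, hnormsq]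
    rfl
  have htm : TendstoInMeasure volume (fun k => (f k).1) Filter.atTop X := by
    refine tendstoInMeasure_of_tendsto_eLpNorm (p := 2) (by simp) (fun k => (hmem k).1)
      (Lp.aestronglyMeasurable X) ?_
    have h1 := (Lp.tendsto_Lp_iff_tendsto_eLpNorm' x X).1 hX
    refine h1.congr fun k => eLpNorm_congr_ae ?_
    exact (hmem k).coeFn_toLp.sub (Filter.EventuallyEq.refl _ _)
  obtain ⟨ns, hns, hae⟩ := htm.exists_seq_tendsto_ae
  exact ⟨fun k => (f (ns k)).1, fun k => (f (ns k)).2, X, fun k => hsub _,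
    Lp.aestronglyMeasurable X, hae, hgain.comp hns.tendsto_atTop⟩

end Limit

/-! ### Passage to the limit and conclusion. -/

set_option synthInstance.maxHeartbeats 200000 in
/-- An almost everywhere limit of strict subsolutions with vanishing defect solves the Euler
equations with pressure `-1/n` on the unit ball and `0` outside. -/
theorem isDistributionalEulerSolution_of_tendsto {n : ℕ} (hn : n ≠ 0)
    {v : ℕ → SpaceTime n → EuclideanSpace ℝ (Fin n)}
    {u : ℕ → SpaceTime n → EuclideanSpace ℝ (Fin n) →L[ℝ] EuclideanSpace ℝ (Fin n) →L[ℝ] ℝ}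
    {V : SpaceTime n → EuclideanSpace ℝ (Fin n)}
    (hsub : ∀ k, IsStrictSubsolution (v k) (u k)) (hVm : AEStronglyMeasurable V)
    (hV1 : ∀ᵐ y, ‖V y‖ ≤ 1)
    (hlim : ∀ᵐ y, Filter.Tendsto (fun k => v k y) Filter.atTop (nhds (V y)))
    (hunit : ∀ᵐ y, y ∈ Metric.ball (0 : SpaceTime n) 1 → ‖V y‖ = 1) :
    IsDistributionalEulerSolution n V
      ((Metric.ball (0 : SpaceTime n) 1).indicator fun _ => -(1 / (n : ℝ))) 0 := by
  set p : SpaceTime n → ℝ := (Metric.ball (0 : SpaceTime n) 1).indicator fun _ => -(1 / (n : ℝ))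
    with hp
  have hnR : (1 : ℝ) ≤ n := by exact_mod_cast Nat.pos_of_ne_zero hn
  have hv1 := fun k y => ((hsub k).norm_lt_one hn y).le
  have hcoord : ∀ (a : EuclideanSpace ℝ (Fin n)) (i : Fin n), |a i| ≤ ‖a‖ := fun a i =>
    PiLp.norm_apply_le a i
  have hcm : ∀ i, AEStronglyMeasurable fun y => V y i := fun i =>
    (by fun_prop : Continuous fun a : EuclideanSpace ℝ (Fin n) => a i).comp_aestronglyMeasurable
      hVm
  have hloc : ∀ {F : Type} [NormedAddCommGroup F] {g : SpaceTime n → F} {C : ℝ},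
      AEStronglyMeasurable g → (∀ᵐ y, ‖g y‖ ≤ C) → LocallyIntegrable g := by
    intro F _ g C hg hb
    refine (memLp_top_of_bound hg C hb).locallyIntegrable (by simp)
  have hcl : ∀ {y} (i : Fin n), Filter.Tendsto (fun k => v k y) Filter.atTop (nhds (V y)) →
      Filter.Tendsto (fun k => v k y i) Filter.atTop (nhds (V y i)) := by
    intro y i h
    exact ((by fun_prop : Continuous fun a : EuclideanSpace ℝ (Fin n) => a i).tendsto _).comp h
  -- In the ball, the defect entries are bounded by `1 - ‖v k y‖ ^ 2 → 0`, so `u k` needs no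
  -- compactness of its own: its limit is dictated by `V`.
  have hul : ∀ᵐ y, ∀ i j, Filter.Tendsto
      (fun k => u k y (EuclideanSpace.single i 1) (EuclideanSpace.single j 1)) Filter.atTop
      (nhds (V y i * V y j + (if i = j then p y else 0))) := by
    filter_upwards [hlim, hunit] with y h1 h2 i j
    by_cases hy : y ∈ Metric.ball (0 : SpaceTime n) 1
    · have hT : Filter.Tendsto (fun k => 1 - ‖v k y‖ ^ 2) Filter.atTop (nhds 0) := by
        have := (tendsto_const_nhds (x := (1 : ℝ))).sub (h1.norm.pow 2)
        rw [h2 hy] at this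
        simpa using this
      have hd := squeeze_zero_norm (f := fun k => (if i = j then 1 else 0) / (n : ℝ)
        - v k y i * v k y j
        + u k y (EuclideanSpace.single i 1) (EuclideanSpace.single j 1)) (fun k => abs_defect_entry_le hn ((hsub k).symm y)
        ((hsub k).trace y) ((hsub k).defectForm_nonneg y) i j) hT
      have h3 := (hd.add ((hcl i h1).mul (hcl j h1))).sub
        (tendsto_const_nhds (x := (if i = j then 1 else 0) / (n : ℝ)))
      have hpy : p y = -(1 / (n : ℝ)) := by simp [hp, Set.indicator_of_mem hy]
      refine (h3.congr fun k => ?_).trans (le_of_eq ?_)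
      · ring
      · congr 1
        rw [hpy]
        split_ifs <;> ring
    · have hz : ∀ k, v k y = 0 := fun k => ((hsub k).eq_zero y hy).1
      have hV0 : V y = 0 := by
        simp only [hz] at h1
        exact (tendsto_nhds_unique tendsto_const_nhds h1).symm
      have hpy : p y = 0 := by simp only [hp, Set.indicator_of_notMem hy]
      have hu0 : ∀ k, u k y = 0 := fun k => ((hsub k).eq_zero y hy).2
      simp [hu0, hpy, hV0]
  -- Domination: the defect entry, `1 / n` and `v i * v j` each contribute at most `1`.
  have hub : ∀ k y i j,
      |u k y (EuclideanSpace.single i 1) (EuclideanSpace.single j 1)| ≤ 3 := by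
    intro k y i j
    have h1 := abs_le.1 (abs_defect_entry_le hn ((hsub k).symm y)
        ((hsub k).trace y) ((hsub k).defectForm_nonneg y) i j)
    have h2 : |v k y i * v k y j| ≤ 1 := by
      rw [abs_mul]
      exact mul_le_one₀ ((hcoord _ i).trans (hv1 k y)) (abs_nonneg _)
        ((hcoord _ j).trans (hv1 k y))
    have h2' := abs_le.1 h2
    have h3 : 0 ≤ (if i = j then 1 else 0) / (n : ℝ) := by positivity
    have h4 : (if i = j then 1 else 0) / (n : ℝ) ≤ 1 := by
      rw [div_le_one (by positivity)]
      split_ifs <;> linarith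
    have h5 := sq_nonneg ‖v k y‖
    rw [abs_le]
    constructor <;> linarith
  have hpm : AEStronglyMeasurable p :=
    (stronglyMeasurable_const.indicator Metric.isOpen_ball.measurableSet).aestronglyMeasurable
  refine ⟨hloc hVm hV1, fun i j => hloc (C := 1) ((hcm i).mul (hcm j)) ?_,
    hloc (C := 1) hpm (Filter.Eventually.of_forall fun y => ?_), ?_, ?_, ?_⟩
  · filter_upwards [hV1] with y hy
    rw [Real.norm_eq_abs, abs_mul]
    exact mul_le_one₀ ((hcoord _ i).trans hy) (abs_nonneg _) ((hcoord _ j).trans hy)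
  · refine (norm_indicator_le_norm_self _ _).trans ?_
    rw [norm_neg, Real.norm_eq_abs, abs_of_nonneg (by positivity), div_le_one (by positivity)]
    exact hnR
  · exact hloc (C := 0) aestronglyMeasurable_const (by simp)
  · intro φ hφ i
    have hT := tendsto_integral_of_dominated_convergence
      (F := fun k y => inner ℝ (v k y) (EuclideanSpace.single i (1 : ℝ)) * timeDeriv φ y
        + ∑ j, u k y (EuclideanSpace.single i 1) (EuclideanSpace.single j 1) * spaceDeriv j φ y)
      (f := fun y => V y i * timeDeriv φ y + ∑ j, V y i * V y j * spaceDeriv j φ y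
        + p y * spaceDeriv i φ y + (0 : SpaceTime n → EuclideanSpace ℝ (Fin n)) y i * φ y)
      (μ := volume) (fun y => |timeDeriv φ y| + ∑ j, 3 * |spaceDeriv j φ y|)
      (fun k => ((hsub k).integrable_momentum hφ _).1) ?_ ?_ ?_
    · refine tendsto_nhds_unique hT ?_
      simp only [(hsub _).momentum φ hφ, tendsto_const_nhds]
    · refine Integrable.add ?_ (integrable_finsetSum _ fun j _ => Integrable.const_mul ?_ _)
      · exact hφ.continuous_timeDeriv.abs.integrable_of_hasCompactSupport
          hφ.hasCompactSupport_timeDeriv.norm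
      · exact (hφ.continuous_spaceDeriv j).abs.integrable_of_hasCompactSupport
          (hφ.hasCompactSupport_spaceDeriv j).norm
    · refine fun k => Filter.Eventually.of_forall fun y => ?_
      rw [Real.norm_eq_abs, inner_single_one]
      refine (abs_add_le _ _).trans (add_le_add ?_ ?_)
      · rw [abs_mul]
        exact mul_le_of_le_one_left (abs_nonneg _) ((hcoord _ i).trans (hv1 k y))
      · refine (Finset.abs_sum_le_sum_abs _ _).trans (Finset.sum_le_sum fun j _ => ?_)
        rw [abs_mul]
        exact mul_le_mul_of_nonneg_right (hub k y i j) (abs_nonneg _)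
    · filter_upwards [hlim, hul] with y h1 h2
      simp only [inner_single_one]
      have h3 := ((hcl i h1).mul_const (timeDeriv φ y)).add
        (tendsto_finsetSum Finset.univ fun j _ => (h2 i j).mul_const (spaceDeriv j φ y))
      convert h3 using 2
      simp [add_mul, Finset.sum_add_distrib, add_assoc]
  · intro φ hφ
    have hT := tendsto_integral_of_dominated_convergence
      (F := fun k y => ∑ i, v k y i * spaceDeriv i φ y)
      (f := fun y => ∑ i, V y i * spaceDeriv i φ y)
      (μ := volume) (fun y => ∑ j, |spaceDeriv j φ y|)
      (fun k => ((hsub k).integrable_incompressible hφ).1) ?_ ?_ ?_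
    · refine tendsto_nhds_unique hT ?_
      simp only [(hsub _).incompressible φ hφ, tendsto_const_nhds]
    · refine integrable_finsetSum _ fun j _ => ?_
      exact (hφ.continuous_spaceDeriv j).abs.integrable_of_hasCompactSupport
          (hφ.hasCompactSupport_spaceDeriv j).norm
    · refine fun k => Filter.Eventually.of_forall fun y => ?_
      refine (Finset.abs_sum_le_sum_abs _ _).trans (Finset.sum_le_sum fun j _ => ?_)
      rw [abs_mul]
      exact mul_le_of_le_one_left (abs_nonneg _) ((hcoord _ j).trans (hv1 k y))
    · filter_upwards [hlim] with y h1
      exact tendsto_finsetSum Finset.univ fun j _ => (hcl j h1).mul_const (spaceDeriv j φ y)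

theorem theorem1 (n : ℕ) (hn : 2 ≤ n) :
    ∃ (v : SpaceTime n → EuclideanSpace ℝ (Fin n)) (p : SpaceTime n → ℝ),
      MemLp v ∞ volume ∧ MemLp p ∞ volume ∧
      IsDistributionalEulerSolution n v p 0 ∧
      ¬ (v =ᵐ[volume] 0) ∧
      HasCompactSupport v ∧ HasCompactSupport p := by
  have hn0 : n ≠ 0 := by omega
  obtain ⟨v, u, X, hsub, hXm, hXlim, hdef⟩ := exists_subsolution_seq hn
  set B := Metric.ball (0 : SpaceTime n) 1 with hB
  have hBm : MeasurableSet B := Metric.isOpen_ball.measurableSet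
  -- `X` is known only almost everywhere; cutting off gives genuinely compact support and keeps the
  -- limit, since every `v k` vanishes outside `B`.
  set V := B.indicator X with hV
  have hVm : AEStronglyMeasurable V := hXm.indicator hBm
  have hlim : ∀ᵐ y, Filter.Tendsto (fun k => v k y) Filter.atTop (nhds (V y)) := by
    filter_upwards [hXlim] with y hy
    by_cases h : y ∈ B
    · rwa [hV, Set.indicator_of_mem h]
    · rw [hV, Set.indicator_of_notMem h]
      simp only [((hsub _).eq_zero y h).1, tendsto_const_nhds]
  have hv1 := fun k y => ((hsub k).norm_lt_one hn0 y).le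
  have hV1 : ∀ᵐ y, ‖V y‖ ≤ 1 := by
    filter_upwards [hlim] with y hy
    exact le_of_tendsto hy.norm (Filter.Eventually.of_forall fun k => hv1 k y)
  have hbd : ∀ a : EuclideanSpace ℝ (Fin n), ‖a‖ ≤ 1 → ‖(1 - ‖a‖ ^ 2) ^ 2‖ ≤ 1 := by
    intro a ha
    have h0 := norm_nonneg a
    rw [Real.norm_eq_abs, abs_of_nonneg (sq_nonneg _)]
    have h1 : 0 ≤ 1 - ‖a‖ ^ 2 := by nlinarith
    have h2 : 1 - ‖a‖ ^ 2 ≤ 1 := by nlinarith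
    exact pow_le_one₀ h1 h2
  have hconst : Integrable (fun _ => (1 : ℝ)) (volume.restrict B) :=
    integrableOn_const measure_ball_lt_top.ne
  have hDm : AEStronglyMeasurable (fun y => (1 - ‖V y‖ ^ 2) ^ 2) (volume.restrict B) :=
    ((by fun_prop : Continuous fun a : EuclideanSpace ℝ (Fin n) =>
      (1 - ‖a‖ ^ 2) ^ 2).comp_aestronglyMeasurable hVm).restrict
  -- Dominated convergence identifies the limit of the squared defects, so `‖V‖ = 1` almost
  -- everywhere in `B`; this also makes `V` nonzero.
  have hzero : ∫ y in B, (1 - ‖V y‖ ^ 2) ^ 2 = 0 := by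
    refine tendsto_nhds_unique (tendsto_integral_of_dominated_convergence
      (F := fun k y => (1 - ‖v k y‖ ^ 2) ^ 2) (fun _ => 1) (fun k => ?_) hconst
      (fun k => Filter.Eventually.of_forall fun y => hbd _ (hv1 k y)) ?_) hdef
    · have := (hsub k).continuous_velocity
      exact Continuous.aestronglyMeasurable (by fun_prop)
    · filter_upwards [ae_restrict_of_ae hlim] with y hy
      exact (tendsto_const_nhds.sub (hy.norm.pow 2)).pow 2
  have hunit : ∀ᵐ y, y ∈ B → ‖V y‖ = 1 := by
    have hi : Integrable (fun y => (1 - ‖V y‖ ^ 2) ^ 2) (volume.restrict B) := by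
      refine hconst.mono hDm ?_
      filter_upwards [ae_restrict_of_ae hV1] with y hy
      simpa using hbd _ hy
    have h0 := (integral_eq_zero_iff_of_nonneg (fun y => sq_nonneg _) hi).1 hzero
    filter_upwards [(ae_restrict_iff' hBm).1 h0] with y hy hyB
    have h1 : (1 - ‖V y‖ ^ 2) ^ 2 = 0 := hy hyB
    have h2 : 1 - ‖V y‖ ^ 2 = 0 := by simpa using h1
    nlinarith [norm_nonneg (V y)]
  have hcs : ∀ {F : Type} [Zero F] (g : SpaceTime n → F), HasCompactSupport (B.indicator g) :=
    fun g => HasCompactSupport.intro (isCompact_closedBall (0 : SpaceTime n) 1) fun y hy =>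
      Set.indicator_of_notMem (fun h => hy (Metric.ball_subset_closedBall h)) _
  refine ⟨V, B.indicator fun _ => -(1 / (n : ℝ)), memLp_top_of_bound hVm 1 hV1, ?_,
    isDistributionalEulerSolution_of_tendsto hn0 hsub hVm hV1 hlim hunit, ?_, hcs X, hcs _⟩
  · refine memLp_top_of_bound (stronglyMeasurable_const.indicator hBm).aestronglyMeasurable
      ‖-(1 / (n : ℝ))‖ (Filter.Eventually.of_forall fun y => ?_)
    exact norm_indicator_le_norm_self _ _
  · intro h0
    have hne : ∀ᵐ y : SpaceTime n, y ∉ B := by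
      filter_upwards [h0, hunit] with y h1 h2 hy
      have := h2 hy
      rw [h1] at this
      simp at this
    have : volume B = 0 := measure_eq_zero_iff_ae_notMem.2 hne
    exact (Metric.measure_ball_pos volume (0 : SpaceTime n) one_pos).ne' this
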